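/- Let $k$ be a field. A variety over $k$ is an integral separated scheme of finite type over $k$; a closed subvariety is an integral closed subscheme. Let $X$ be a normal variety over $k$, let $S\subset X$ be a closed subvariety with generic point $\eta_S$, and let $\gamma:\widetilde S\to S$ be a finite surjective morphism over $k$ from a normal variety $\widetilde S$. Suppose that at least one of the following conditions holds: (i) the residue field $\kappa(\eta_S)$ is perfect; (ii) $X$ is regular at $\eta_S$, i.e. $\mathcal O_{X,\eta_S}$ is a regular local ring. Then there exist a normal variety $\widetilde X$ over $k$, a finite surjective morphism $\rho:\widetilde X\to X$ over $k$, a closed subvariety $\widehat S\subset\widetilde X$, and a morphism $\nu:\widetilde S\to\widehat S$ such that: (1) $\rho$ restricts to a surjective morphism $\rho|_{\widehat S}:\widehat S\to S$, and $\rho|_{\widehat S}\circ\nu=\gamma$; (2) $\nu$ is the normalisation of $\widehat S$; (3) $\deg\rho=\deg\gamma$, where the degree of a finite surjective morphism $Z\to Y$ of integral schemes is the degree $[K(Z):K(Y)]$ of the extension of function fields. -/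

import Mathlib

open CategoryTheory AlgebraicGeometry

universe u

noncomputable section

/-- A variety over `k`, given by its structure morphism: an integral separated scheme of finite type
over `k`. -/
structure IsVarietyOver {k : Type u} [Field k] {X : Scheme.{u}}
    (p : X ⟶ Spec (CommRingCat.of k)) : Prop where
  isIntegral : IsIntegral X
  isSeparated : IsSeparated p
  locallyOfFiniteType : LocallyOfFiniteType p
  quasiCompact : QuasiCompact p

/-- A scheme is normal if all of its local rings are integrally closed domains. -/
def IsNormalScheme (X : Scheme.{u}) : Prop :=
  ∀ x : X, IsDomain (X.presheaf.stalk x) ∧ IsIntegrallyClosed (X.presheaf.stalk x)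

/-- A scheme is regular at a point if the local ring there is a regular local ring. -/
def IsRegularAtPoint (X : Scheme.{u}) (x : X) : Prop :=
  IsRegularLocalRing (X.presheaf.stalk x)

lemma specializes_map_genericPoint {X Y : Scheme.{u}} [IsIntegral X] [IsIntegral Y]
    (f : X ⟶ Y) [IsDominant f] : f (genericPoint X) ⤳ genericPoint Y := by
  have h := (genericPoint_spec X).image f.continuous
  rw [Set.image_univ, f.denseRange.closure_range] at h
  exact h.specializes trivial

/-- The inclusion of function fields `K(Y) → K(X)` induced by a dominant morphism `f : X ⟶ Y` of
integral schemes. -/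
def functionFieldMap {X Y : Scheme.{u}} [IsIntegral X] [IsIntegral Y] (f : X ⟶ Y) [IsDominant f] :
    Y.functionField ⟶ X.functionField :=
  Y.presheaf.stalkSpecializes (specializes_map_genericPoint f) ≫ f.stalkMap (genericPoint X)

/-- The degree `[K(X) : K(Y)]` of a dominant morphism `f : X ⟶ Y` of integral schemes. It is a
positive integer if `f` is finite. -/
def morphismDegree {X Y : Scheme.{u}} [IsIntegral X] [IsIntegral Y] (f : X ⟶ Y) [IsDominant f] :
    ℕ :=
  letI := (functionFieldMap f).hom.toAlgebra
  Module.finrank Y.functionField X.functionField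

/-- The morphism `Spec K(Y) ⟶ Y` given by the generic point of an integral scheme. -/
def fromSpecFunctionField (Y : Scheme.{u}) [IsIntegral Y] : Spec Y.functionField ⟶ Y :=
  Y.fromSpecStalk (genericPoint Y)

instance quasiCompact_fromSpecFunctionField (Y : Scheme.{u}) [IsIntegral Y] :
    QuasiCompact (fromSpecFunctionField Y) where
  isCompact_preimage _ _ _ :=
    haveI : Subsingleton (Spec Y.functionField) :=
      inferInstanceAs (Subsingleton (PrimeSpectrum Y.functionField))
    Set.subsingleton_of_subsingleton.isCompact

instance quasiSeparated_fromSpecFunctionField (Y : Scheme.{u}) [IsIntegral Y] :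
    QuasiSeparated (fromSpecFunctionField Y) := by
  unfold fromSpecFunctionField
  infer_instance

/-- `ν : Z ⟶ Y` is the normalisation of the integral scheme `Y`: as a scheme over `Y`, `Z` is
isomorphic to the relative normalisation of `Y` in `Spec K(Y)`. -/
def IsNormalisation {Z Y : Scheme.{u}} [IsIntegral Y] (ν : Z ⟶ Y) : Prop :=
  ∃ e : Z ≅ (fromSpecFunctionField Y).normalization,
    e.hom ≫ (fromSpecFunctionField Y).fromNormalization = ν

end

/-! Let R be the local ring of X at η_S, κ its residue field, K = K(X) and F = K(S̃), a finite
extension of κ. Everything reduces to field theory over R: it suffices to find a finite separable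
L/K with [L : K] = [F : κ] and a surjection from the integral closure of R in L onto F that extends
R → κ → F.

Given these, X̃ is the normalisation of X in L. It is normal, finite over X because L/K is
separable, and of degree [L : K]. The surjection defines an F-valued point of X̃ over Spec F → S̃ →
S → X (`exists_point_normalization`), and Ŝ is its closure. The residue field at this point is all
of F, so K(Ŝ) = F; since S̃ is normal and integral over S, it is the normalisation of Ŝ
(`exists_isNormalisation_image`, `exists_finite_covering`).

If κ is perfect, write F = κ(α) and lift the minimal polynomial of α to a monic f over R. Then f' is
a unit in R[X]/f, and a discriminant computation shows that R[X]/f is the whole integral closure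
(`IsIntegrallyClosed.exists_separable_extension`).

If R is regular but not a field, F/κ may be inseparable. Adjoin one element at a time, choosing each
lift f with f' ≠ 0, which a summand mX with 0 ≠ m in the maximal ideal achieves. Then R[X]/f is
local with maximal ideal generated by that of R, hence regular, hence a domain, and the extension of
fraction fields is separable (`IsRegularLocalRing.exists_separable_extension`). The map onto F must
still be extended to the full integral closure; normality of the regular ring would do, but a
residue map on its integral closure is enough.

If R is a field, then S = X and X̃ = S̃ works. -/

/-! ### Regular local rings modulo a member of a minimal system of generators. -/

section RegularLocalRing

open IsLocalRing Ideal

/-- An element of `m \ m²` is part of a minimal system of generators of `m`. -/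
lemma exists_finset_span_insert_eq_maximalIdeal {R : Type*} [CommRing R] [IsLocalRing R]
    [IsNoetherianRing R] {x : R} (hx : x ∈ maximalIdeal R) (hx2 : x ∉ maximalIdeal R ^ 2) :
    ∃ s : Finset R, span (insert x (s : Set R)) = maximalIdeal R ∧
      s.card + 1 = (maximalIdeal R).spanFinrank := by
  classical
  set m := maximalIdeal R
  let x' : m := ⟨x, hx⟩
  set v : CotangentSpace R := m.toCotangent x'
  have hv : v ≠ 0 := by
    intro h
    exact hx2 ((m.toCotangent_eq_zero x').mp h)
  have hli : LinearIndepOn (ResidueField R) id ({v} : Set (CotangentSpace R)) :=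
    LinearIndepOn.singleton hv
  let b := Module.Basis.extend hli
  set t := hli.extend (Set.subset_univ _)
  have hvt : v ∈ t := hli.subset_extend _ rfl
  have : Fintype t := FiniteDimensional.fintypeBasisIndex b
  -- The class of x must lift to x itself; all other basis vectors lift arbitrarily, and Nakayama
  -- shows that the lifts generate.
  let g : CotangentSpace R → m := fun w ↦ if w = v then x' else
    Function.surjInv m.toCotangent_surjective w
  have hg : ∀ w, m.toCotangent (g w) = w := by
    intro w
    by_cases h : w = v
    · simp only [g, if_pos h]; exact h.symm
    · simp only [g, if_neg h]
      exact Function.surjInv_eq m.toCotangent_surjective w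
  have hspan : Submodule.span R (g '' t) = ⊤ := by
    rw [← CotangentSpace.span_image_eq_top_iff, ← Set.image_comp]
    have : (m.toCotangent ∘ g) '' t = t := by
      conv_rhs => rw [← Set.image_id t]
      exact Set.image_congr fun w _ ↦ hg w
    rw [this]
    exact top_le_iff.mp fun y _ ↦ hli.subset_span_extend (Set.subset_univ _) (Set.mem_univ y)
  refine ⟨((t.toFinset).erase v).image (fun w ↦ (g w : R)), ?_, ?_⟩
  · have h1 : insert x (((t.toFinset).erase v).image (fun w ↦ (g w : R)) : Set R) =
        m.subtype '' (g '' t) := by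
      have : x = g v := by simp [g, x']
      rw [this, ← Set.image_comp]
      simp only [Finset.coe_image, Finset.coe_erase, Set.coe_toFinset]
      rw [← Set.image_insert_eq (f := fun w ↦ (g w : R)), Set.insert_sdiff_singleton,
        Set.insert_eq_of_mem hvt]
      rfl
    rw [h1, Ideal.span, ← Submodule.map_span, hspan, Submodule.map_top, Submodule.range_subtype]
  · rw [Finset.card_image_of_injective, Finset.card_erase_of_mem (by simpa using hvt),
      spanFinrank_maximalIdeal_eq_finrank_cotangentSpace, Module.finrank_eq_card_basis b,
      Set.toFinset_card, Nat.sub_add_cancel]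
    · exact Fintype.card_pos_iff.mpr ⟨⟨v, hvt⟩⟩
    · intro w w' h
      rw [← hg w, ← hg w', Subtype.ext h]

/-- Passing to R/(x) removes one generator of the maximal ideal and lowers the dimension by at most
one, so the number of generators cannot exceed the dimension of the quotient. -/
lemma IsRegularLocalRing.quotient_span_singleton {R : Type*} [CommRing R] [IsRegularLocalRing R]
    {x : R} (hx : x ∈ maximalIdeal R) (hx2 : x ∉ maximalIdeal R ^ 2) :
    IsRegularLocalRing (R ⧸ span {x}) ∧
      (maximalIdeal R).spanFinrank = ringKrullDim (R ⧸ span {x}) + 1 := by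
  classical
  obtain ⟨s, hs, hcard⟩ := exists_finset_span_insert_eq_maximalIdeal hx hx2
  have hne : span {x} ≠ ⊤ := by
    intro h
    exact (maximalIdeal.isMaximal R).ne_top
      (top_le_iff.mp (h ▸ (span_singleton_le_iff_mem _).mpr hx))
  have : Nontrivial (R ⧸ span {x}) := Ideal.Quotient.nontrivial_iff.mpr hne
  have hloc : IsLocalRing (R ⧸ span {x}) :=
    .of_surjective' (Ideal.Quotient.mk _) Ideal.Quotient.mk_surjective
  have hmax : maximalIdeal (R ⧸ span {x}) = span ((Ideal.Quotient.mk (span {x})) '' s) := by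
    have h1 : (maximalIdeal R).map (Ideal.Quotient.mk (span {x})) = maximalIdeal _ :=
      IsLocalRing.map_maximalIdeal_of_surjective _ Ideal.Quotient.mk_surjective
    rw [← h1, ← hs, Ideal.map_span, Set.image_insert_eq,
      Ideal.Quotient.eq_zero_iff_mem.mpr (mem_span_singleton_self x), Ideal.span_insert_zero]
  have hle : (maximalIdeal (R ⧸ span {x})).spanFinrank ≤ s.card := by
    rw [hmax]
    refine (Submodule.spanFinrank_span_le_ncard_of_finite (s.finite_toSet.image _)).trans ?_
    refine (Set.ncard_image_le s.finite_toSet).trans ?_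
    simp
  have hdim : ((maximalIdeal R).spanFinrank : WithBot ℕ∞) ≤ ringKrullDim (R ⧸ span {x}) + 1 := by
    rw [IsRegularLocalRing.spanFinrank_maximalIdeal]
    have := ringKrullDim_le_ringKrullDim_quotient_add_card ({x} : Finset R) (by
      rw [IsLocalRing.ringJacobson_eq_maximalIdeal]; simpa using hx)
    rwa [Finset.coe_singleton, Finset.card_singleton, Nat.cast_one] at this
  have hle' : (s.card : WithBot ℕ∞) ≤ ringKrullDim (R ⧸ span {x}) := by
    rw [← hcard, ← IsLocalRing.maximalIdeal_height_eq_ringKrullDim] at hdim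
    rw [← IsLocalRing.maximalIdeal_height_eq_ringKrullDim]
    have h : (s.card : ℕ∞) + 1 ≤ (maximalIdeal (R ⧸ span {x})).height + 1 := by exact_mod_cast hdim
    exact_mod_cast (ENat.add_le_add_iff_right ENat.one_ne_top).mp h
  have hreg := IsRegularLocalRing.of_spanFinrank_maximalIdeal_le (R ⧸ span {x})
    ((by exact_mod_cast hle :
      ((maximalIdeal (R ⧸ span {x})).spanFinrank : WithBot ℕ∞) ≤ s.card).trans
      hle')
  refine ⟨hreg, le_antisymm hdim ?_⟩
  rw [← IsRegularLocalRing.spanFinrank_maximalIdeal, ← hcard]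
  push_cast
  gcongr

/-- Prime avoidance. Domains are not yet available here, so x is kept out of every minimal prime in
order to deduce later that zero is the only one. -/
lemma IsRegularLocalRing.exists_notMem_sq_notMem_minimalPrimes {R : Type*} [CommRing R]
    [IsRegularLocalRing R] (h : maximalIdeal R ≠ ⊥) :
    ∃ x ∈ maximalIdeal R, x ∉ maximalIdeal R ^ 2 ∧ ∀ p ∈ minimalPrimes R, x ∉ p := by
  by_contra! hcon
  have hfin := (minimalPrimes.finite_of_isNoetherianRing R).insert (maximalIdeal R ^ 2)
  have hsub : (maximalIdeal R : Set R) ⊆ ⋃ I ∈ insert (maximalIdeal R ^ 2) (minimalPrimes R),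
      (I : Set R) := by
    intro x hx
    by_cases hx2 : x ∈ maximalIdeal R ^ 2
    · exact Set.mem_biUnion (Set.mem_insert _ _) hx2
    · obtain ⟨p, hp, hxp⟩ := hcon x hx hx2
      exact Set.mem_biUnion (Set.mem_insert_of_mem _ hp) hxp
  -- Prime avoidance tolerates two non-prime ideals; 𝔪² occupies both exceptional slots.
  obtain ⟨I, hI, hle⟩ := (subset_union_prime_finite hfin (f := id) (maximalIdeal R ^ 2)
    (maximalIdeal R ^ 2) (fun I hI h _ ↦ (hI.resolve_left h).1.1)).mp hsub
  rcases hI with rfl | hI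
  · have : IsIdempotentElem (maximalIdeal R) := by
      rw [IsIdempotentElem, ← pow_two]
      exact le_antisymm (Ideal.pow_le_self two_ne_zero) hle
    rcases (Ideal.isIdempotentElem_iff_eq_bot_or_top_of_isLocalRing _).mp this with h' | h'
    · exact h h'
    · exact (maximalIdeal.isMaximal R).ne_top h'
  · have hprime : I.IsPrime := hI.1.1
    have hIm : I = maximalIdeal R := le_antisymm (le_maximalIdeal hprime.ne_top) hle
    -- If 𝔪 were a minimal prime, R would have dimension 0, and regularity would force 𝔪 = 0.
    have h0 : (maximalIdeal R).height = 0 := by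
      rw [← hIm, Ideal.height_eq_zero_iff]
      exact hI
    have : ((maximalIdeal R).spanFinrank : WithBot ℕ∞) = 0 := by
      rw [IsRegularLocalRing.spanFinrank_maximalIdeal,
        ← IsLocalRing.maximalIdeal_height_eq_ringKrullDim, h0]; rfl
    exact h ((Submodule.spanFinrank_eq_zero_iff_eq_bot (IsNoetherian.noetherian _)).mp
      (by exact_mod_cast this))

end RegularLocalRing


/-! ### Residue maps on the integral closure of a regular local ring. -/

section RegularLocalRing

open IsLocalRing Ideal

lemma RingHom.exists_comp_eq_of_forall_mem_range {A B C : Type*} [CommRing A] [CommRing B]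
    [CommRing C] (f : B →+* C) (hf : Function.Injective f) (g : A →+* C)
    (h : ∀ a, g a ∈ f.range) : ∃ k : A →+* B, f.comp k = g := by
  let e : B ≃+* f.range := RingEquiv.ofBijective f.rangeRestrict
    ⟨fun a b hab ↦ hf (congrArg Subtype.val hab), f.rangeRestrict_surjective⟩
  refine ⟨e.symm.toRingHom.comp (g.codRestrict f.range h), RingHom.ext fun a ↦ ?_⟩
  have : (e (e.symm (g.codRestrict f.range h a)) : C) = g a := by simp
  exact this

/-- If `x` is a nonunit of a noetherian local ring lying in no minimal prime and `(x)` is prime,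
then the ring is a domain. -/
lemma IsLocalRing.isDomain_of_isPrime_span_singleton {R : Type*} [CommRing R] [IsLocalRing R]
    [IsNoetherianRing R] {x : R} (hx : x ∈ maximalIdeal R) (hmin : ∀ p ∈ minimalPrimes R, x ∉ p)
    [hp : (span {x}).IsPrime] : IsDomain R := by
  obtain ⟨p, hp, hle⟩ := Ideal.exists_minimalPrimes_le (bot_le (a := span {x}))
  have hprime : p.IsPrime := hp.1.1
  have hxp := hmin p hp
  have : p = ⊥ := by
    -- Nakayama: y = zx in p with x ∉ p forces z ∈ p, so p ⊆ 𝔪p.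
    refine Submodule.eq_bot_of_le_smul_of_le_jacobson_bot (maximalIdeal R) p
      (IsNoetherian.noetherian _) ?_ (IsLocalRing.jacobson_eq_maximalIdeal _ bot_ne_top).ge
    intro y hy
    obtain ⟨z, rfl⟩ := mem_span_singleton'.mp (hle hy)
    rw [mul_comm]
    exact Submodule.smul_mem_smul hx ((hprime.mem_or_mem hy).resolve_right hxp)
  subst this
  exact IsDomain.of_bot_isPrime R

/-- If `(x)` is a prime ideal of a noetherian domain, then a residue map on the integral closure of
`R / x` induces one on the integral closure of `R`. -/
lemma exists_ringHom_integralClosure_of_quotient {R : Type u} [CommRing R] [IsDomain R]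
    [IsNoetherianRing R] (x : R) [hp : (span {x}).IsPrime] {k : Type*} [CommRing k]
    (ψ : integralClosure (R ⧸ span {x}) (span {x}).ResidueField →+* k)
    (L : Type*) [Field L] [Algebra R L] [IsFractionRing R L] :
    ∃ φ : integralClosure R L →+* k, ∀ r : R, φ (algebraMap R _ r) =
      ψ (algebraMap (R ⧸ span {x}) _ (Ideal.Quotient.mk _ r)) := by
  set P := span {x}
  let V := Localization.AtPrime P
  have hunit : ∀ y : P.primeCompl, IsUnit (algebraMap R L y) := by
    intro y
    rw [isUnit_iff_ne_zero, Ne, FaithfulSMul.algebraMap_eq_zero_iff]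
    rintro h
    exact y.2 (h ▸ P.zero_mem)
  let : Algebra V L := (IsLocalization.lift (S := V) hunit).toAlgebra
  have : IsScalarTower R V L := .of_algebraMap_eq fun r ↦ (IsLocalization.lift_eq hunit r).symm
  have : IsFractionRing V L :=
    IsFractionRing.isFractionRing_of_isDomain_of_isLocalization P.primeCompl V L
  have : IsDomain V := IsLocalization.isDomain_localization P.primeCompl_le_nonZeroDivisors
  have : IsNoetherianRing V := IsLocalization.isNoetherianRing P.primeCompl V inferInstance
  -- V is a noetherian local domain with principal maximal ideal, so it is a discrete valuation ring
  -- or a field, and normal in either case. Elements of L integral over R therefore lie in V and can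
  -- be reduced to the residue field of P.
  have hprinc : (maximalIdeal V).IsPrincipal := by
    refine ⟨algebraMap R V x, ?_⟩
    rw [← Localization.AtPrime.map_eq_maximalIdeal, Ideal.map_span, Set.image_singleton]
  have hded : IsDedekindDomain V :=
    ((tfae_of_isNoetherianRing_of_isLocalRing_of_isDomain V).out 4 2).mp hprinc
  have hint : IsIntegrallyClosed V := inferInstance
  obtain ⟨α, hα⟩ := RingHom.exists_comp_eq_of_forall_mem_range (algebraMap V L)
    (IsFractionRing.injective V L) (integralClosure R L).val.toRingHom
    (fun c ↦ IsIntegrallyClosed.isIntegral_iff.mp (IsIntegral.tower_top (R := R) c.2))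
  have hα' : ∀ r, α (algebraMap R _ r) = algebraMap R V r := by
    intro r
    apply IsFractionRing.injective V L
    rw [← RingHom.comp_apply, hα, ← IsScalarTower.algebraMap_apply]
    rfl
  let θ : integralClosure R L →+* P.ResidueField := (residue V).comp α
  have hθ : ∀ r, θ (algebraMap R _ r) =
      algebraMap (R ⧸ P) P.ResidueField (Ideal.Quotient.mk _ r) := by
    intro r
    simp only [θ, RingHom.comp_apply, hα']
    rfl
  -- The reduction of an integral equation over R is one over R/P, so θ lands where ψ is defined.
  have hθint : ∀ c, IsIntegral (R ⧸ P) (θ c) := by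
    intro c
    have hc : IsIntegral R c := (isIntegral_algebraMap_iff (A := integralClosure R L) (B := L)
      Subtype.val_injective).mp c.2
    let : Algebra R P.ResidueField := (θ.comp (algebraMap R _)).toAlgebra
    obtain ⟨f, hf, h0⟩ := hc
    refine ⟨f.map (Ideal.Quotient.mk P), hf.map _, ?_⟩
    rw [Polynomial.eval₂_map]
    have : (algebraMap (R ⧸ P) P.ResidueField).comp (Ideal.Quotient.mk P) =
        θ.comp (algebraMap R _) := RingHom.ext fun r ↦ (hθ r).symm
    rw [this, ← Polynomial.hom_eval₂, h0, map_zero]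
  refine ⟨ψ.comp (θ.codRestrict (integralClosure (R ⧸ P) P.ResidueField) hθint), fun r ↦ ?_⟩
  rw [RingHom.comp_apply]
  congr 1
  exact Subtype.ext (hθ r)

/-- Induction on the embedding dimension through R/(x). The quotient is a domain, so (x) is prime
and R is a domain; the residue map for R/(x) then pulls back along localisation at (x). Both claims
share one induction because the second needs (x) to be prime. -/
theorem IsRegularLocalRing.isDomain_and_exists_ringHom (n : ℕ) : ∀ (R : Type u) [CommRing R]
    [IsRegularLocalRing R], (maximalIdeal R).spanFinrank = n → IsDomain R ∧
      ∀ (L : Type u) [Field L] [Algebra R L] [IsFractionRing R L],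
        ∃ ψ : integralClosure R L →+* ResidueField R,
          ∀ r, ψ (algebraMap R _ r) = residue R r := by
  induction n with
  | zero =>
    intro R _ _ h0
    have hbot := (Submodule.spanFinrank_eq_zero_iff_eq_bot (IsNoetherian.noetherian _)).mp h0
    have hf : IsField R := IsLocalRing.isField_iff_maximalIdeal_eq.mpr hbot
    let := hf.toField
    refine ⟨inferInstance, fun L _ _ _ ↦ ?_⟩
    obtain ⟨α, hα⟩ := RingHom.exists_comp_eq_of_forall_mem_range (algebraMap R L)
      (IsFractionRing.injective R L) (integralClosure R L).val.toRingHom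
      (fun c ↦ IsIntegrallyClosed.isIntegral_iff.mp c.2)
    refine ⟨(residue R).comp α, fun r ↦ ?_⟩
    rw [RingHom.comp_apply]
    congr 1
    apply IsFractionRing.injective R L
    rw [← RingHom.comp_apply, hα]
    rfl
  | succ n ih =>
    intro R _ _ hn
    have hbot : maximalIdeal R ≠ ⊥ := by
      intro h
      rw [h, Submodule.spanFinrank_bot] at hn
      omega
    obtain ⟨x, hx, hx2, hmin⟩ := IsRegularLocalRing.exists_notMem_sq_notMem_minimalPrimes hbot
    obtain ⟨hreg, hdim⟩ := IsRegularLocalRing.quotient_span_singleton hx hx2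
    have hn' : (maximalIdeal (R ⧸ span {x})).spanFinrank = n := by
      rw [← IsRegularLocalRing.spanFinrank_maximalIdeal, hn] at hdim
      have : n + 1 = (maximalIdeal (R ⧸ span {x})).spanFinrank + 1 := by exact_mod_cast hdim
      omega
    obtain ⟨hdom, hψ⟩ := ih (R ⧸ span {x}) hn'
    have hprime : (span {x}).IsPrime := (Ideal.Quotient.isDomain_iff_prime _).mp hdom
    have hR : IsDomain R := IsLocalRing.isDomain_of_isPrime_span_singleton hx hmin
    refine ⟨hR, fun L _ _ _ ↦ ?_⟩
    obtain ⟨ψ, hψ⟩ := hψ (span {x}).ResidueField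
    have : IsLocalHom (Ideal.Quotient.mk (span {x})) :=
      .of_surjective _ Ideal.Quotient.mk_surjective
    have hsurj : Function.Surjective (ResidueField.map (Ideal.Quotient.mk (span {x}))) := by
      intro y
      obtain ⟨y, rfl⟩ := residue_surjective y
      obtain ⟨y, rfl⟩ := Ideal.Quotient.mk_surjective y
      exact ⟨residue R y, rfl⟩
    let e := RingEquiv.ofBijective (ResidueField.map (Ideal.Quotient.mk (span {x})))
      ⟨RingHom.injective _, hsurj⟩
    obtain ⟨φ, hφ⟩ := exists_ringHom_integralClosure_of_quotient x
      (e.symm.toRingHom.comp ψ) L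
    refine ⟨φ, fun r ↦ ?_⟩
    rw [hφ, RingHom.comp_apply, hψ]
    apply e.injective
    simp only [RingEquiv.toRingHom_eq_coe, RingHom.coe_coe, RingEquiv.apply_symm_apply]
    rfl

theorem IsRegularLocalRing.isDomain (R : Type u) [CommRing R] [IsRegularLocalRing R] :
    IsDomain R :=
  (IsRegularLocalRing.isDomain_and_exists_ringHom _ R rfl).1

theorem IsRegularLocalRing.exists_ringHom_integralClosure (R : Type u) [CommRing R]
    [IsRegularLocalRing R] (L : Type u) [Field L] [Algebra R L] [IsFractionRing R L] :
    ∃ ψ : integralClosure R L →+* ResidueField R, ∀ r, ψ (algebraMap R _ r) = residue R r :=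
  (IsRegularLocalRing.isDomain_and_exists_ringHom _ R rfl).2 L

end RegularLocalRing


/-! ### Monogenic extensions R[X]/f lifting a minimal polynomial over the residue field. -/

section MonogenicExtension

open IsLocalRing Ideal Polynomial

variable {R : Type*} [CommRing R] [IsLocalRing R] {F : Type*} [Field F]
  [Algebra (ResidueField R) F]

lemma Polynomial.eval₂_algebraMap_comp_residue (α : F) (g : R[X]) :
    g.eval₂ ((algebraMap (ResidueField R) F).comp (residue R)) α =
      aeval α (g.map (residue R)) := by
  rw [aeval_def, eval₂_map]

/-- The kernel of evaluation at `α`, where `f` lifts the minimal polynomial of `α` over the residue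
field, is generated by the maximal ideal. -/
lemma AdjoinRoot.ker_lift_eq_map_maximalIdeal (α : F) (f : R[X])
    (hf : f.map (residue R) = minpoly (ResidueField R) α)
    (h0 : f.eval₂ ((algebraMap (ResidueField R) F).comp (residue R)) α = 0) :
    RingHom.ker (AdjoinRoot.lift _ α h0) = (maximalIdeal R).map (AdjoinRoot.of f) := by
  apply le_antisymm
  · intro b hb
    obtain ⟨g, rfl⟩ := AdjoinRoot.mk_surjective b
    rw [RingHom.mem_ker, AdjoinRoot.lift_mk, eval₂_algebraMap_comp_residue] at hb
    obtain ⟨q', hq'⟩ := minpoly.dvd _ _ hb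
    obtain ⟨q, rfl⟩ := Polynomial.map_surjective _ residue_surjective q'
    have h1 : g - f * q ∈ RingHom.ker (mapRingHom (residue R)) := by
      rw [RingHom.mem_ker, coe_mapRingHom, Polynomial.map_sub, Polynomial.map_mul, hf, hq',
          sub_self]
    rw [Polynomial.ker_mapRingHom, ker_residue] at h1
    have h2 := Ideal.mem_map_of_mem (AdjoinRoot.mk f) h1
    rw [Ideal.map_map, map_sub, map_mul, AdjoinRoot.mk_self, zero_mul, sub_zero] at h2
    exact h2
  · rw [Ideal.map_le_iff_le_comap]
    intro r hr
    rw [Ideal.mem_comap, RingHom.mem_ker, AdjoinRoot.lift_of, RingHom.comp_apply,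
      (residue_eq_zero_iff r).mpr hr, map_zero]

/-- If `f` is monic and lifts the minimal polynomial of `α` over the residue field, then
`R[X] / f` is local, its maximal ideal being generated by that of `R`. -/
lemma AdjoinRoot.isLocalRing_of_map_residue_eq_minpoly (α : F) (f : R[X]) (hm : f.Monic)
    (hf : f.map (residue R) = minpoly (ResidueField R) α)
    (h0 : f.eval₂ ((algebraMap (ResidueField R) F).comp (residue R)) α = 0) :
    ∃ _ : IsLocalRing (AdjoinRoot f),
      maximalIdeal (AdjoinRoot f) = (maximalIdeal R).map (AdjoinRoot.of f) ∧
      RingHom.ker (AdjoinRoot.lift _ α h0) = maximalIdeal (AdjoinRoot f) := by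
  have : Module.Finite R (AdjoinRoot f) := hm.finite_adjoinRoot
  have hker := AdjoinRoot.ker_lift_eq_map_maximalIdeal α f hf h0
  have hcomap : (RingHom.ker (AdjoinRoot.lift _ α h0)).comap (algebraMap R (AdjoinRoot f)) =
      maximalIdeal R := by
    ext r
    rw [Ideal.mem_comap, RingHom.mem_ker, AdjoinRoot.algebraMap_eq, AdjoinRoot.lift_of,
      RingHom.comp_apply, map_eq_zero, residue_eq_zero_iff]
  have hmax : (RingHom.ker (AdjoinRoot.lift _ α h0)).IsMaximal := by
    have : (RingHom.ker (AdjoinRoot.lift _ α h0)).IsPrime := RingHom.ker_isPrime _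
    apply Ideal.isMaximal_of_isIntegral_of_isMaximal_comap (R := R)
    rw [hcomap]
    infer_instance
  have hloc : IsLocalRing (AdjoinRoot f) := by
    refine .of_unique_max_ideal ⟨_, hmax, fun M hM ↦ ?_⟩
    have hMc := Ideal.isMaximal_comap_of_isIntegral_of_isMaximal (R := R) M
    refine (hmax.eq_of_le hM.ne_top ?_).symm
    rw [hker, Ideal.map_le_iff_le_comap, ← AdjoinRoot.algebraMap_eq]
    exact (eq_maximalIdeal hMc).ge
  refine ⟨hloc, ?_, eq_maximalIdeal hmax⟩
  rw [← hker]
  exact (eq_maximalIdeal hmax).symm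

/-- A monic polynomial over the residue field of a local domain that is not a field has a monic lift
with nonzero derivative. -/
lemma Polynomial.exists_monic_lift_derivative_ne_zero [IsDomain R] (hR : maximalIdeal R ≠ ⊥)
    (p : (ResidueField R)[X]) (hp : p.Monic) (hdeg : p.natDegree ≠ 0) :
    ∃ f : R[X], f.Monic ∧ f.map (residue R) = p ∧ f.natDegree = p.natDegree ∧
      derivative f ≠ 0 := by
  obtain ⟨f, hf, hdf, hmf⟩ := lifts_and_natDegree_eq_and_monic
    ((mem_lifts p).mpr (Polynomial.map_surjective _ residue_surjective p)) hp
  by_cases hder : derivative f = 0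
  · have h1 : f.natDegree ≠ 1 := by
      intro h1
      rw [hmf.eq_X_add_C h1] at hder
      simp at hder
    -- Adding mX leaves the reduction unchanged and makes the derivative m; it does not disturb the
    -- leading term, since a monic f with zero derivative does not have degree 1.
    obtain ⟨m, hm, hm0⟩ := Submodule.exists_mem_ne_zero_of_ne_bot hR
    have hlt : (C m * X).degree < f.degree := by
      refine (degree_C_mul_X_le m).trans_lt ?_
      rw [degree_eq_natDegree hmf.ne_zero]
      exact_mod_cast (by omega : 1 < f.natDegree)
    refine ⟨f + C m * X, hmf.add_of_left hlt, ?_, ?_, ?_⟩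
    · rw [Polynomial.map_add, hf, Polynomial.map_mul, map_C, (residue_eq_zero_iff m).mpr hm]
      simp
    · rw [← hdf]
      exact natDegree_eq_of_degree_eq (degree_add_eq_left_of_degree_lt hlt)
    · rw [derivative_add, hder]
      simpa using hm0
  · exact ⟨f, hmf, hf, hdf, hder⟩

end MonogenicExtension

/-! ### Separability of the fraction field of R[X]/f. -/

section Separable

open IsLocalRing Ideal Polynomial

/-- If `R[X] / f` is a domain and `f' ≠ 0`, then the extension of fraction fields is separable. -/
lemma AdjoinRoot.isSeparable_fractionField {R : Type*} [CommRing R] [IsDomain R] (f : R[X])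
    (hm : f.Monic) (hf : derivative f ≠ 0) [IsDomain (AdjoinRoot f)]
    (K L : Type*) [Field K] [Field L] [Algebra R K] [IsFractionRing R K] [Algebra (AdjoinRoot f) L]
    [IsFractionRing (AdjoinRoot f) L] [Algebra K L] [Algebra R L] [IsScalarTower R K L]
    [IsScalarTower R (AdjoinRoot f) L] : Algebra.IsSeparable K L := by
  set β : L := algebraMap (AdjoinRoot f) L (AdjoinRoot.root f)
  have haev : ∀ g : R[X], algebraMap (AdjoinRoot f) L (AdjoinRoot.mk f g) =
      aeval β (g.map (algebraMap R K)) := by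
    intro g
    rw [aeval_map_algebraMap, aeval_algebraMap_apply, AdjoinRoot.aeval_eq]
  have hβf : aeval β (f.map (algebraMap R K)) = 0 := by
    rw [← haev, AdjoinRoot.mk_self, map_zero]
  have hβ : IsIntegral K β := ⟨f.map (algebraMap R K), hm.map _, by rwa [← aeval_def]⟩
  -- Normality of R is not needed: a multiple of the minimal polynomial with denominators cleared
  -- vanishes in R[X]/f, because this domain embeds in L. It is thus divisible by f, which bounds
  -- the degree of f.
  have hmin : minpoly K β = f.map (algebraMap R K) := by
    refine (eq_of_monic_of_dvd_of_natDegree_le (minpoly.monic hβ) (hm.map _)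
      (minpoly.dvd _ _ hβf) ?_).symm
    obtain ⟨c, hc0, hc⟩ := IsLocalization.integerNormalization_spec (nonZeroDivisors R)
      (minpoly K β)
    set g := IsLocalization.integerNormalization (nonZeroDivisors R) (minpoly K β)
    have hg : AdjoinRoot.mk f g = 0 := by
      apply IsFractionRing.injective (AdjoinRoot f) L
      rw [haev, hc, map_zero, ← algebraMap_smul K c (minpoly K β), map_smul, minpoly.aeval,
          smul_zero]
    have hc0' : c ≠ 0 := nonZeroDivisors.ne_zero hc0
    have hg0 : g.map (algebraMap R K) ≠ 0 := by
      rw [hc]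
      exact smul_ne_zero hc0' (minpoly.ne_zero hβ)
    have hg0' : g ≠ 0 := fun h ↦ hg0 (by rw [h, Polynomial.map_zero])
    calc (f.map (algebraMap R K)).natDegree ≤ f.natDegree := natDegree_map_le
      _ ≤ g.natDegree := natDegree_le_of_dvd (AdjoinRoot.mk_eq_zero.mp hg) hg0'
      _ = (g.map (algebraMap R K)).natDegree :=
        (natDegree_map_eq_of_injective (IsFractionRing.injective R K) g).symm
      _ ≤ (minpoly K β).natDegree := by rw [hc]; exact natDegree_smul_le _ _
  have hsep : IsSeparable K β := by
    rw [IsSeparable, separable_iff_derivative_ne_zero (minpoly.irreducible hβ), hmin,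
      derivative_map]
    exact (Polynomial.map_ne_zero_iff (IsFractionRing.injective R K)).mpr hf
  have htop : IntermediateField.adjoin K {β} = ⊤ := by
    rw [eq_top_iff]
    intro z _
    obtain ⟨a, b, -, rfl⟩ := IsFractionRing.div_surjective (A := AdjoinRoot f) z
    obtain ⟨a, rfl⟩ := AdjoinRoot.mk_surjective a
    obtain ⟨b, rfl⟩ := AdjoinRoot.mk_surjective b
    rw [haev, haev]
    have hmem : ∀ p : K[X], aeval β p ∈ IntermediateField.adjoin K {β} := fun p ↦
      IntermediateField.algebra_adjoin_le_adjoin K {β} (aeval_mem_adjoin_singleton K β)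
    exact div_mem (hmem _) (hmem _)
  have : Algebra.IsSeparable K (⊤ : IntermediateField K L) := by
    rw [← htop]
    exact (IntermediateField.isSeparable_adjoin_simple_iff_isSeparable K L).mpr hsep
  exact Algebra.IsSeparable.of_equiv_equiv (RingEquiv.refl K)
    (IntermediateField.topEquiv (F := K) (E := L)).toRingEquiv (by ext; rfl)

end Separable


/-! ### Weakly unramified extensions. -/

section WeaklyUnramified

open IsLocalRing Ideal Polynomial

/-- A finite free local extension of local rings such that the maximal ideal of the base generates
the maximal ideal, and such that the extension of fraction fields is separable. -/
structure IsWeaklyUnramifiedExtension (R B : Type u) [CommRing R] [IsLocalRing R] [CommRing B]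
    [IsLocalRing B] [Algebra R B] : Prop where
  finite : Module.Finite R B
  free : Module.Free R B
  map_maximalIdeal : (maximalIdeal R).map (algebraMap R B) = maximalIdeal B
  isSeparable : ∀ (K L : Type u) [Field K] [Field L] [Algebra R K] [IsFractionRing R K]
    [Algebra B L] [IsFractionRing B L] [Algebra K L] [Algebra R L] [IsScalarTower R K L]
    [IsScalarTower R B L], Algebra.IsSeparable K L

lemma IsWeaklyUnramifiedExtension.refl (R : Type u) [CommRing R] [IsLocalRing R] :
    IsWeaklyUnramifiedExtension R R where
  finite := inferInstance
  free := inferInstance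
  map_maximalIdeal := Ideal.map_id _
  isSeparable K L _ _ _ _ aB _ _ aR _ h := by
    -- L carries two R-algebra structures, one for B = R and one for the base; the scalar tower
    -- identifies them.
    obtain rfl : aB = aR := by
      refine Algebra.algebra_ext _ _ fun r ↦ ?_
      exact (@IsScalarTower.algebraMap_apply R R L _ _ _ _ aB aR h r).symm
    have hsurj : Function.Surjective (algebraMap K L) := by
      intro z
      obtain ⟨a, b, -, rfl⟩ := IsFractionRing.div_surjective (A := R) z
      refine ⟨algebraMap R K a / algebraMap R K b, ?_⟩
      rw [map_div₀, ← IsScalarTower.algebraMap_apply, ← IsScalarTower.algebraMap_apply]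
    exact ⟨fun z ↦ by obtain ⟨z, rfl⟩ := hsurj z; exact isSeparable_algebraMap z⟩

lemma IsWeaklyUnramifiedExtension.trans {R B C : Type u} [CommRing R] [IsLocalRing R] [CommRing B]
    [IsLocalRing B] [CommRing C] [IsLocalRing C] [IsDomain R] [IsDomain B] [IsDomain C]
    [Algebra R B] [Algebra B C] [Algebra R C] [IsScalarTower R B C]
    (h₁ : IsWeaklyUnramifiedExtension R B) (h₂ : IsWeaklyUnramifiedExtension B C) :
    IsWeaklyUnramifiedExtension R C where
  finite := have := h₁.finite; have := h₂.finite; .trans B C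
  free := have := h₁.free; have := h₂.free; .trans (S := B)
  map_maximalIdeal := by
    rw [IsScalarTower.algebraMap_eq R B C, ← Ideal.map_map, h₁.map_maximalIdeal,
      h₂.map_maximalIdeal]
  isSeparable K L _ _ _ _ _ _ _ _ _ _ := by
    have := h₁.free
    have := h₂.free
    let M := FractionRing B
    have hRB : Function.Injective (algebraMap R B) := FaithfulSMul.algebraMap_injective R B
    have hBC : Function.Injective (algebraMap B C) := FaithfulSMul.algebraMap_injective B C
    have hRM : Function.Injective (algebraMap R M) :=
      (FaithfulSMul.algebraMap_injective B M).comp hRB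
    have hBL : Function.Injective ((algebraMap C L).comp (algebraMap B C)) :=
      (IsFractionRing.injective C L).comp hBC
    let : Algebra B L := ((algebraMap C L).comp (algebraMap B C)).toAlgebra
    have : IsScalarTower B C L := .of_algebraMap_eq' rfl
    let : Algebra K M := (IsFractionRing.lift (K := K) hRM).toAlgebra
    let : Algebra M L := (IsFractionRing.lift (K := M) hBL).toAlgebra
    have : IsScalarTower R K M :=
      .of_algebraMap_eq fun r ↦ (IsFractionRing.lift_algebraMap hRM r).symm
    have : IsScalarTower B M L :=
      .of_algebraMap_eq fun r ↦ (IsFractionRing.lift_algebraMap hBL r).symm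
    have hRL : ∀ r, algebraMap R L r = algebraMap B L (algebraMap R B r) := by
      intro r
      rw [IsScalarTower.algebraMap_apply R C L, IsScalarTower.algebraMap_apply R B C,
        ← IsScalarTower.algebraMap_apply B C L]
    have : IsScalarTower K M L := by
      refine .of_algebraMap_eq' (IsLocalization.ringHom_ext (nonZeroDivisors R) ?_)
      ext r
      simp only [RingHom.comp_apply]
      rw [← IsScalarTower.algebraMap_apply R K L, ← IsScalarTower.algebraMap_apply R K M,
        IsScalarTower.algebraMap_apply R B M, ← IsScalarTower.algebraMap_apply B M L, hRL]
    have := h₁.isSeparable K M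
    have := h₂.isSeparable M L
    exact Algebra.IsSeparable.trans K M L

/-- The generators of the maximal ideal of R also generate that of B, while going-down for the flat
extension gives dim B ≥ dim R. -/
lemma IsRegularLocalRing.of_finite_free {R B : Type u} [CommRing R]
    [IsRegularLocalRing R] [CommRing B] [IsLocalRing B] [Algebra R B] [Module.Finite R B]
    [Module.Free R B] (h : (maximalIdeal R).map (algebraMap R B) = maximalIdeal B) :
    IsRegularLocalRing B := by
  have : IsNoetherianRing B := IsNoetherianRing.of_finite R B
  have : (maximalIdeal B).LiesOver (maximalIdeal R) := by
    refine ⟨le_antisymm ?_ (le_maximalIdeal ?_)⟩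
    · rw [Ideal.under, ← Ideal.map_le_iff_le_comap, h]
    · exact Ideal.comap_ne_top _ (maximalIdeal.isMaximal B).ne_top
  apply IsRegularLocalRing.of_spanFinrank_maximalIdeal_le
  calc ((maximalIdeal B).spanFinrank : WithBot ℕ∞) ≤ (maximalIdeal R).spanFinrank := by
        rw [← h]
        exact_mod_cast Ideal.spanFinrank_map_le_of_fg _ (IsNoetherian.noetherian _)
    _ = ringKrullDim R := IsRegularLocalRing.spanFinrank_maximalIdeal
    _ = (maximalIdeal R).height := IsLocalRing.maximalIdeal_height_eq_ringKrullDim.symm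
    _ ≤ (maximalIdeal B).height := by
        rw [Ideal.height_eq_height_add_of_liesOver_of_hasGoingDown (maximalIdeal R)
          (maximalIdeal B)]
        exact_mod_cast le_self_add
    _ = ringKrullDim B := IsLocalRing.maximalIdeal_height_eq_ringKrullDim

/-- A single algebraic element of an extension of the residue field can be realised in the residue
field of a weakly unramified extension. -/
lemma IsWeaklyUnramifiedExtension.exists_of_isIntegral {R : Type u} [CommRing R]
    [IsRegularLocalRing R] (hR : maximalIdeal R ≠ ⊥) {F : Type u} [Field F]
    [Algebra (ResidueField R) F] {α : F} (hα : IsIntegral (ResidueField R) α) :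
    ∃ (B : Type u) (_ : CommRing B) (_ : IsLocalRing B) (_ : Algebra R B)
      (φ : B →+* F), IsWeaklyUnramifiedExtension R B ∧ IsLocalHom φ ∧ α ∈ φ.range ∧
      φ.comp (algebraMap R B) = (algebraMap (ResidueField R) F).comp (residue R) := by
  have := IsRegularLocalRing.isDomain R
  obtain ⟨f, hm, hf, hdeg, hder⟩ := Polynomial.exists_monic_lift_derivative_ne_zero hR
    (minpoly (ResidueField R) α) (minpoly.monic hα) (minpoly.natDegree_pos hα).ne'
  have h0 : f.eval₂ ((algebraMap (ResidueField R) F).comp (residue R)) α = 0 := by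
    rw [Polynomial.eval₂_algebraMap_comp_residue, hf, minpoly.aeval]
  obtain ⟨hloc, hmax, hker⟩ := AdjoinRoot.isLocalRing_of_map_residue_eq_minpoly α f hm hf h0
  have := hm.finite_adjoinRoot
  have := hm.free_adjoinRoot
  have := IsRegularLocalRing.of_finite_free hmax.symm
  have := IsRegularLocalRing.isDomain (AdjoinRoot f)
  refine ⟨AdjoinRoot f, inferInstance, hloc, inferInstance, AdjoinRoot.lift _ α h0,
    ⟨hm.finite_adjoinRoot, hm.free_adjoinRoot, hmax.symm,
      fun K L ↦ AdjoinRoot.isSeparable_fractionField f hm hder K L⟩,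
    ⟨fun b hb ↦ ?_⟩, ⟨AdjoinRoot.root f, AdjoinRoot.lift_root h0⟩, AdjoinRoot.lift_comp_of h0⟩
  by_contra hcon
  have : b ∈ maximalIdeal (AdjoinRoot f) := hcon
  rw [← hker, RingHom.mem_ker] at this
  rw [this] at hb
  exact not_isUnit_zero hb

end WeaklyUnramified


/-! ### Arbitrary finite residue extensions over a regular local ring. -/

section ResidueExtension

open IsLocalRing Ideal Polynomial

/-- A finite extension of the residue field of a regular local ring that is not a field is the
residue field of a weakly unramified extension. -/
theorem IsWeaklyUnramifiedExtension.exists_surjective (n : ℕ) : ∀ (R : Type u) [CommRing R]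
    [IsRegularLocalRing R], maximalIdeal R ≠ ⊥ → ∀ (F : Type u) [Field F]
    [Algebra (ResidueField R) F] [FiniteDimensional (ResidueField R) F],
    Module.finrank (ResidueField R) F = n →
    ∃ (B : Type u) (_ : CommRing B) (_ : IsRegularLocalRing B) (_ : Algebra R B)
      (φ : B →+* F), IsWeaklyUnramifiedExtension R B ∧ Function.Surjective φ ∧
      φ.comp (algebraMap R B) = (algebraMap (ResidueField R) F).comp (residue R) := by
  induction n using Nat.strong_induction_on with
  | _ n ih =>
  intro R _ _ hR F _ _ _ hn
  by_cases hsurj : Function.Surjective (algebraMap (ResidueField R) F)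
  · exact ⟨R, inferInstance, inferInstance, inferInstance,
      (algebraMap (ResidueField R) F).comp (residue R), .refl R, hsurj.comp residue_surjective, rfl⟩
  have hint : Algebra.IsIntegral (ResidueField R) F := .of_finite _ _
  -- Realising an α outside the image of the residue field enlarges that field strictly, so the
  -- remaining degree drops and the induction applies to B.
  obtain ⟨α, hα⟩ := not_forall.mp hsurj
  obtain ⟨B, _, _, _, φ, hB, hφ, ⟨b, hb⟩, hcomp⟩ :=
    IsWeaklyUnramifiedExtension.exists_of_isIntegral hR (hint.isIntegral α)
  have := hB.finite
  have := hB.free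
  have hreg : IsRegularLocalRing B := IsRegularLocalRing.of_finite_free hB.map_maximalIdeal
  have := IsRegularLocalRing.isDomain R
  have := IsRegularLocalRing.isDomain B
  have hloc : IsLocalHom (algebraMap R B) :=
    ((local_hom_TFAE (algebraMap R B)).out 0 2).mpr hB.map_maximalIdeal.le
  let : Algebra (ResidueField B) F := (ResidueField.lift φ).toAlgebra
  have hres : ∀ b, algebraMap (ResidueField B) F (residue B b) = φ b := fun b ↦
    ResidueField.lift_residue_apply φ b
  have : IsScalarTower (ResidueField R) (ResidueField B) F := by
    refine .of_algebraMap_eq fun r ↦ ?_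
    obtain ⟨r, rfl⟩ := residue_surjective r
    have h1 : algebraMap (ResidueField R) (ResidueField B) (residue R r) =
      residue B (algebraMap R B r) := rfl
    rw [h1, hres]
    exact (RingHom.congr_fun hcomp r).symm
  have : FiniteDimensional (ResidueField B) F := .of_restrictScalars_finite (ResidueField R) _ _
  have : FiniteDimensional (ResidueField R) (ResidueField B) := .left _ _ F
  have hmul := Module.finrank_mul_finrank (ResidueField R) (ResidueField B) F
  have hpos : 0 < Module.finrank (ResidueField B) F := Module.finrank_pos
  have hpos' : 0 < Module.finrank (ResidueField R) (ResidueField B) := Module.finrank_pos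
  have hne : Module.finrank (ResidueField R) (ResidueField B) ≠ 1 := by
    intro h1
    have hbij := Algebra.finrank_eq_one_iff_bijective_algebraMap.mp h1
    obtain ⟨r, hr⟩ := hbij.2 (residue B b)
    exact hα ⟨r, by rw [IsScalarTower.algebraMap_apply _ (ResidueField B) F, hr, hres]; exact hb⟩
  have hlt : Module.finrank (ResidueField B) F < n := by
    rw [← hn, ← hmul]
    exact lt_mul_of_one_lt_left hpos (by omega)
  have hB0 : maximalIdeal B ≠ ⊥ := by
    rw [← hB.map_maximalIdeal]
    rwa [Ne, Ideal.map_eq_bot_iff_of_injective (FaithfulSMul.algebraMap_injective R B)]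
  obtain ⟨C, _, _, _, ψ, hC, hψ, hψcomp⟩ := ih _ hlt B hB0 F rfl
  have := IsRegularLocalRing.isDomain C
  let : Algebra R C := ((algebraMap B C).comp (algebraMap R B)).toAlgebra
  have : IsScalarTower R B C := .of_algebraMap_eq' rfl
  refine ⟨C, inferInstance, inferInstance, inferInstance, ψ, hB.trans hC, hψ, ?_⟩
  rw [IsScalarTower.algebraMap_eq R B C, ← RingHom.comp_assoc, hψcomp, ← hcomp]
  ext r
  exact hres _

/-- The rank of a free module can be read off modulo the maximal ideal of R, and there B becomes its
residue field F. -/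
lemma IsWeaklyUnramifiedExtension.finrank_eq {R B F : Type u} [CommRing R] [IsLocalRing R]
    [CommRing B] [IsLocalRing B] [Algebra R B] (h : IsWeaklyUnramifiedExtension R B) [Field F]
    [Algebra (ResidueField R) F] (φ : B →+* F) (hφ : Function.Surjective φ)
    (hcomp : φ.comp (algebraMap R B) = (algebraMap (ResidueField R) F).comp (residue R)) :
    Module.finrank R B = Module.finrank (ResidueField R) F := by
  have := h.finite
  have := h.free
  rw [← IsLocalRing.finrank_quotient_map (R := R) (S := B)]
  have hker : RingHom.ker φ = (maximalIdeal R).map (algebraMap R B) := by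
    rw [h.map_maximalIdeal]
    have := RingHom.ker_isMaximal_of_surjective φ hφ
    exact eq_maximalIdeal this
  let e : (B ⧸ (maximalIdeal R).map (algebraMap R B)) ≃+* F :=
    (Ideal.quotEquivOfEq hker.symm).trans (RingHom.quotientKerEquivOfSurjective hφ)
  refine Algebra.finrank_eq_of_equiv_equiv (RingEquiv.refl (ResidueField R)) e ?_
  ext r
  exact (RingHom.congr_fun hcomp r).symm

/-- A finite extension of the residue field of a regular local ring that is not a field is the
residue field at a prime of the integral closure in a separable extension of the same degree. -/
theorem IsRegularLocalRing.exists_separable_extension (R : Type u) [CommRing R]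
    [IsRegularLocalRing R] (hR : ¬ IsField R) (K : Type u) [Field K] [Algebra R K]
    [IsFractionRing R K] (F : Type u) [Field F] [Algebra (ResidueField R) F]
    [FiniteDimensional (ResidueField R) F] :
    ∃ (L : Type u) (_ : Field L) (_ : Algebra K L) (_ : Algebra R L) (_ : IsScalarTower R K L),
      FiniteDimensional K L ∧ Algebra.IsSeparable K L ∧
      Module.finrank K L = Module.finrank (ResidueField R) F ∧
      ∃ φ : integralClosure R L →+* F, Function.Surjective φ ∧
        φ.comp (algebraMap R _) = (algebraMap (ResidueField R) F).comp (residue R) := by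
  obtain ⟨B, _, _, _, φ, hB, hφ, hcomp⟩ := IsWeaklyUnramifiedExtension.exists_surjective _ R
    (mt IsLocalRing.isField_iff_maximalIdeal_eq.mpr hR) F rfl
  have := IsRegularLocalRing.isDomain R
  have := IsRegularLocalRing.isDomain B
  have := hB.finite
  have := hB.free
  let L := FractionRing B
  have hRL : Function.Injective (algebraMap R L) :=
    (IsFractionRing.injective B L).comp (FaithfulSMul.algebraMap_injective R B)
  let : Algebra K L := (IsFractionRing.lift (K := K) hRL).toAlgebra
  have : IsScalarTower R K L :=
    .of_algebraMap_eq fun r ↦ (IsFractionRing.lift_algebraMap hRL r).symm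
  have hrank : Module.finrank K L = Module.finrank R B := IsFractionRing.finrank_eq ..
  have hrank' := hB.finrank_eq φ hφ hcomp
  refine ⟨L, inferInstance, inferInstance, inferInstance, inferInstance, ?_,
    hB.isSeparable K L, hrank.trans hrank', ?_⟩
  · apply FiniteDimensional.of_finrank_pos
    rw [hrank, hrank']
    exact Module.finrank_pos
  -- Normality of B has not been established, so φ cannot be used directly on the integral closure
  -- of R. That ring lies in the integral closure of B, whose residue map ψ restricts to the
  -- reduction on B, through which φ factors.
  obtain ⟨ψ, hψ⟩ := IsRegularLocalRing.exists_ringHom_integralClosure B L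
  have hφloc : IsLocalHom φ := .of_surjective φ hφ
  let ι : integralClosure R L →+* integralClosure B L :=
    (integralClosure R L).val.toRingHom.codRestrict (integralClosure B L)
      fun c ↦ IsIntegral.tower_top (R := R) c.2
  have hB' : ∀ b : B, IsIntegral R (algebraMap B L b) := fun b ↦
    (Algebra.IsIntegral.isIntegral (R := R) b).algebraMap
  have hval : ∀ (b : B), (ResidueField.lift φ).comp (ψ.comp ι) ⟨algebraMap B L b, hB' b⟩ = φ b := by
    intro b
    have : ι ⟨algebraMap B L b, hB' b⟩ = algebraMap B _ b := rfl
    rw [RingHom.comp_apply, RingHom.comp_apply, this, hψ, ResidueField.lift_residue_apply]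
  refine ⟨(ResidueField.lift φ).comp (ψ.comp ι), fun y ↦ ?_, ?_⟩
  · obtain ⟨b, rfl⟩ := hφ y
    exact ⟨_, hval b⟩
  · rw [← hcomp]
    ext r
    exact hval (algebraMap R B r)

end ResidueExtension


/-! ### Separable residue extensions over a normal local ring. -/

section SeparableResidueExtension

open IsLocalRing Ideal Polynomial

/-- If `f'(β)` is a unit among the integral elements, where `f` is the minimal polynomial of the
integral generator `β`, then `R[β]` is the full integral closure. -/
lemma PowerBasis.mem_adjoin_of_isIntegral_inv_derivative {R K L : Type*} [CommRing R] [IsDomain R]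
    [IsIntegrallyClosed R] [Field K] [Algebra R K] [IsFractionRing R K] [Field L] [Algebra K L]
    [Algebra R L] [IsScalarTower R K L] [FiniteDimensional K L] [Algebra.IsSeparable K L]
    (P : PowerBasis K L) (hP : IsIntegral R P.gen) {v : L} (hv : IsIntegral R v)
    (huv : v * aeval P.gen (derivative (minpoly K P.gen)) = 1) {z : L} (hz : IsIntegral R z) :
    z ∈ Algebra.adjoin R ({P.gen} : Set L) := by
  -- The discriminant carries z into R[β]. Up to sign it is the norm of f'(β), whose inverse is the
  -- norm of v; as R is integrally closed, that norm lies in R, and the discriminant can be divided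
  -- out.
  have h1 := Algebra.discr_mul_isIntegral_mem_adjoin K hP hz
  rw [Algebra.discr_powerBasis_eq_norm] at h1
  obtain ⟨w, hw⟩ := IsIntegrallyClosed.isIntegral_iff.mp (Algebra.isIntegral_norm K hv)
  have h2 : algebraMap R K w * Algebra.norm K (aeval P.gen (derivative (minpoly K P.gen))) = 1 := by
    rw [hw, ← map_mul, huv, map_one]
  set e := Module.finrank K L * (Module.finrank K L - 1) / 2
  have h3 : ((-1) ^ e * w) • (((-1) ^ e * Algebra.norm K (aeval P.gen
      (derivative (minpoly K P.gen)))) • z) = z := by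
    rw [← algebraMap_smul K, smul_smul, map_mul, map_pow, map_neg, map_one, mul_mul_mul_comm,
      h2, ← mul_pow]
    simp
  rw [← h3]
  exact Subalgebra.smul_mem _ h1 _

/-- If `f'` is a unit in `R[X] / f`, then `R[X] / f` is integrally closed in the field generated by
a root of `f`, which is a separable extension. -/
lemma Polynomial.isSeparable_and_exists_integralClosure_ringHom {R K L : Type*} [CommRing R]
    [IsDomain R] [IsIntegrallyClosed R] [Field K] [Algebra R K] [IsFractionRing R K] [Field L]
    [Algebra K L] [Algebra R L] [IsScalarTower R K L] [FiniteDimensional K L] (P : PowerBasis K L)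
    (f : R[X]) (hm : f.Monic) (hmin : minpoly K P.gen = f.map (algebraMap R K))
    (hunit : IsUnit (AdjoinRoot.mk f (derivative f))) :
    Algebra.IsSeparable K L ∧ ∃ θ : integralClosure R L →+* AdjoinRoot f, Function.Surjective θ ∧
      θ.comp (algebraMap R _) = AdjoinRoot.of f := by
  let ι : AdjoinRoot f →+* L := AdjoinRoot.lift (algebraMap R L) P.gen (by
    rw [← aeval_def, ← aeval_map_algebraMap K, ← hmin, minpoly.aeval])
  have hιmk : ∀ g : R[X], ι (AdjoinRoot.mk f g) = aeval P.gen (g.map (algebraMap R K)) := by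
    intro g
    rw [AdjoinRoot.lift_mk, aeval_map_algebraMap, aeval_def]
  have hιof : ∀ r : R, ι (algebraMap R _ r) = algebraMap R L r := fun r ↦ AdjoinRoot.lift_of _
  have hιinj : Function.Injective ι := by
    rw [injective_iff_map_eq_zero]
    intro b hb
    obtain ⟨g, rfl⟩ := AdjoinRoot.mk_surjective b
    rw [hιmk] at hb
    have hdvd := minpoly.dvd _ _ hb
    rw [hmin, Polynomial.map_dvd_map _ (IsFractionRing.injective R K) hm] at hdvd
    exact AdjoinRoot.mk_eq_zero.mpr hdvd
  have hfin : Module.Finite R (AdjoinRoot f) := hm.finite_adjoinRoot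
  let ιa : AdjoinRoot f →ₐ[R] L := ⟨ι, hιof⟩
  have hιint : ∀ b, IsIntegral R (ι b) := fun b ↦
    (Algebra.IsIntegral.isIntegral (R := R) b).map ιa
  obtain ⟨v, hv⟩ := hunit.exists_left_inv
  have hv' : ι v * aeval P.gen (derivative (minpoly K P.gen)) = 1 := by
    rw [hmin, derivative_map, ← hιmk, ← map_mul, hv, map_one]
  have hsepP : IsSeparable K P.gen := by
    rw [IsSeparable, separable_iff_derivative_ne_zero (minpoly.irreducible P.isIntegral_gen)]
    intro h
    rw [h, map_zero, mul_zero] at hv'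
    exact zero_ne_one hv'
  have hsep : Algebra.IsSeparable K L := by
    have : Algebra.IsSeparable K (⊤ : IntermediateField K L) := by
      have htop : IntermediateField.adjoin K {P.gen} = ⊤ := by
        rw [← IntermediateField.toSubalgebra_inj,
          IntermediateField.adjoin_simple_toSubalgebra_of_isAlgebraic
            (Algebra.IsAlgebraic.isAlgebraic _), P.adjoin_gen_eq_top,
          IntermediateField.top_toSubalgebra]
      rw [← htop]
      exact (IntermediateField.isSeparable_adjoin_simple_iff_isSeparable K L).mpr hsepP
    exact Algebra.IsSeparable.of_equiv_equiv (RingEquiv.refl K)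
      (IntermediateField.topEquiv (F := K) (E := L)).toRingEquiv (by ext; rfl)
  have hPint : IsIntegral R P.gen := by
    have := hιint (AdjoinRoot.root f)
    rwa [show ι (AdjoinRoot.root f) = P.gen from AdjoinRoot.lift_root _] at this
  have hrange : ∀ c : integralClosure R L, (integralClosure R L).val.toRingHom c ∈ ι.range := by
    intro c
    have hc := PowerBasis.mem_adjoin_of_isIntegral_inv_derivative P hPint (hιint v) hv' c.2
    rw [Algebra.adjoin_singleton_eq_range_aeval] at hc
    obtain ⟨g, hg⟩ := hc
    exact ⟨AdjoinRoot.mk f g, by rw [hιmk, aeval_map_algebraMap]; exact hg⟩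
  obtain ⟨θ, hθ⟩ := RingHom.exists_comp_eq_of_forall_mem_range ι hιinj _ hrange
  have hθι : ∀ b, θ ⟨ι b, hιint b⟩ = b := by
    intro b
    apply hιinj
    rw [← RingHom.comp_apply, hθ]
    rfl
  refine ⟨hsep, θ, fun b ↦ ⟨_, hθι b⟩, ?_⟩
  ext r
  have h1 : algebraMap R (integralClosure R L) r = ⟨ι (algebraMap R _ r), hιint _⟩ :=
    Subtype.ext (hιof r).symm
  rw [RingHom.comp_apply, h1, hθι]
  rfl

/-- A finite separable extension of the residue field of a normal local ring is the residue field at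
a prime of the integral closure in a separable extension of the same degree. -/
theorem IsIntegrallyClosed.exists_separable_extension (R : Type u) [CommRing R] [IsDomain R]
    [IsLocalRing R] [IsIntegrallyClosed R] (K : Type u) [Field K] [Algebra R K]
    [IsFractionRing R K] (F : Type u) [Field F] [Algebra (ResidueField R) F]
    [FiniteDimensional (ResidueField R) F] [Algebra.IsSeparable (ResidueField R) F] :
    ∃ (L : Type u) (_ : Field L) (_ : Algebra K L) (_ : Algebra R L) (_ : IsScalarTower R K L),
      FiniteDimensional K L ∧ Algebra.IsSeparable K L ∧
      Module.finrank K L = Module.finrank (ResidueField R) F ∧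
      ∃ φ : integralClosure R L →+* F, Function.Surjective φ ∧
        φ.comp (algebraMap R _) = (algebraMap (ResidueField R) F).comp (residue R) := by
  let P₀ := Field.powerBasisOfFiniteOfSeparable (IsLocalRing.ResidueField R) F
  set α := P₀.gen
  have hα : IsIntegral (IsLocalRing.ResidueField R) α := P₀.isIntegral_gen
  obtain ⟨f, hf, hdeg, hm⟩ := lifts_and_natDegree_eq_and_monic ((mem_lifts _).mpr
    (Polynomial.map_surjective _ residue_surjective (minpoly (IsLocalRing.ResidueField R) α)))
    (minpoly.monic hα)
  have h0 : f.eval₂ ((algebraMap (IsLocalRing.ResidueField R) F).comp (residue R)) α = 0 := by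
    rw [Polynomial.eval₂_algebraMap_comp_residue, hf, minpoly.aeval]
  obtain ⟨hloc, hmax, hker⟩ := AdjoinRoot.isLocalRing_of_map_residue_eq_minpoly α f hm hf h0
  set φ := AdjoinRoot.lift _ α h0
  have hφ : Function.Surjective φ := by
    intro y
    obtain ⟨p, rfl⟩ := P₀.exists_eq_aeval' y
    obtain ⟨p, rfl⟩ := Polynomial.map_surjective _ residue_surjective p
    exact ⟨AdjoinRoot.mk f p, by
      rw [AdjoinRoot.lift_mk, Polynomial.eval₂_algebraMap_comp_residue]⟩
  have hsepα : (minpoly (IsLocalRing.ResidueField R) α).Separable :=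
    Algebra.IsSeparable.isSeparable _ α
  -- Separability makes the image of f' in F nonzero, and the kernel of the map to F is the only
  -- maximal ideal.
  have hunit : IsUnit (AdjoinRoot.mk f (derivative f)) := by
    by_contra hcon
    have : AdjoinRoot.mk f (derivative f) ∈ maximalIdeal (AdjoinRoot f) := hcon
    rw [← hker, RingHom.mem_ker, AdjoinRoot.lift_mk, Polynomial.eval₂_algebraMap_comp_residue,
      ← derivative_map, hf] at this
    exact hsepα.aeval_derivative_ne_zero (minpoly.aeval _ _) this
  -- Irreducibility lifts from the residue field to R, and Gauss's lemma over the integrally closed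
  -- R carries it to K.
  have hirr : Irreducible f :=
    hm.irreducible_of_irreducible_map (residue R) f (hf ▸ minpoly.irreducible hα)
  have hirrK : Irreducible (f.map (algebraMap R K)) :=
    hm.irreducible_iff_irreducible_map_fraction_map.mp hirr
  have : Fact (Irreducible (f.map (algebraMap R K))) := ⟨hirrK⟩
  have hmK := hm.map (algebraMap R K)
  let P := AdjoinRoot.powerBasis hmK.ne_zero
  have hfd := P.finite
  have hPdeg : P.dim = f.natDegree := by
    rw [AdjoinRoot.powerBasis_dim, hm.natDegree_map]
  obtain ⟨hsep, θ, hθ, hθR⟩ := Polynomial.isSeparable_and_exists_integralClosure_ringHom P f hm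
    (AdjoinRoot.minpoly_powerBasis_gen_of_monic hmK) hunit
  refine ⟨AdjoinRoot (f.map (algebraMap R K)), inferInstance, inferInstance, inferInstance,
    inferInstance, hfd, hsep, ?_, φ.comp θ, hφ.comp hθ, ?_⟩
  · rw [P.finrank, hPdeg, hdeg, P₀.natDegree_minpoly, P₀.finrank]
  · rw [RingHom.comp_assoc, hθR]
    exact AdjoinRoot.lift_comp_of h0

end SeparableResidueExtension


/-! ### Function field maps and degrees. -/

section FunctionFieldMap

lemma SpecMap_functionFieldMap_fromSpecFunctionField {X Y : Scheme.{u}} [IsIntegral X]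
    [IsIntegral Y] (f : X ⟶ Y) [IsDominant f] :
    Spec.map (functionFieldMap f) ≫ fromSpecFunctionField Y = fromSpecFunctionField X ≫ f := by
  rw [functionFieldMap, Spec.map_comp, Category.assoc, fromSpecFunctionField,
    Scheme.SpecMap_stalkSpecializes_fromSpecStalk, Scheme.SpecMap_stalkMap_fromSpecStalk,
    fromSpecFunctionField]

lemma SpecMap_functionFieldMap_fromSpecFunctionField_assoc {X Y Z : Scheme.{u}} [IsIntegral X]
    [IsIntegral Y] (f : X ⟶ Y) [IsDominant f] (g : Y ⟶ Z) :
    Spec.map (functionFieldMap f) ≫ fromSpecFunctionField Y ≫ g =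
      fromSpecFunctionField X ≫ f ≫ g := by
  rw [← Category.assoc, SpecMap_functionFieldMap_fromSpecFunctionField, Category.assoc]

instance mono_fromSpecFunctionField (Y : Scheme.{u}) [IsIntegral Y] :
    Mono (fromSpecFunctionField Y) := by
  unfold fromSpecFunctionField
  infer_instance

/-- The generic point Spec K(Y) → Y is a monomorphism, so maps of function fields can be compared as
morphisms of schemes; functoriality then becomes formal. -/
lemma functionFieldMap_eq_of_comp_eq {X Y : Scheme.{u}} [IsIntegral X]
    [IsIntegral Y] (f : X ⟶ Y) [IsDominant f] (h : Y.functionField ⟶ X.functionField)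
    (H : Spec.map h ≫ fromSpecFunctionField Y = fromSpecFunctionField X ≫ f) :
    functionFieldMap f = h := by
  apply Spec.map_injective
  rw [← cancel_mono (fromSpecFunctionField Y), H, SpecMap_functionFieldMap_fromSpecFunctionField]

lemma functionFieldMap_comp {X Y Z : Scheme.{u}} [IsIntegral X] [IsIntegral Y] [IsIntegral Z]
    (f : X ⟶ Y) (g : Y ⟶ Z) [IsDominant f] [IsDominant g] :
    functionFieldMap (f ≫ g) = functionFieldMap g ≫ functionFieldMap f :=
  functionFieldMap_eq_of_comp_eq _ _ (by
    rw [Spec.map_comp, Category.assoc, SpecMap_functionFieldMap_fromSpecFunctionField,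
      SpecMap_functionFieldMap_fromSpecFunctionField_assoc])

instance isIso_functionFieldMap {X Y : Scheme.{u}} [IsIntegral X] [IsIntegral Y] (f : X ⟶ Y)
    [IsIso f] : IsIso (functionFieldMap f) := by
  refine ⟨functionFieldMap (inv f), ?_, ?_⟩
  · rw [← functionFieldMap_comp]
    exact functionFieldMap_eq_of_comp_eq _ _ (by simp)
  · rw [← functionFieldMap_comp]
    exact functionFieldMap_eq_of_comp_eq _ _ (by simp)

/-- The degree only depends on the function field map up to isomorphisms of fields. -/
lemma morphismDegree_eq_finrank {X Y : Scheme.{u}} [IsIntegral X] [IsIntegral Y] (f : X ⟶ Y)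
    [IsDominant f] {K L : Type u} [Field K] [Field L] [Algebra K L] (e₁ : K ≃+* Y.functionField)
    (e₂ : L ≃+* X.functionField)
    (h : (functionFieldMap f).hom.comp (e₁ : K →+* Y.functionField) =
      (e₂ : L →+* X.functionField).comp (algebraMap K L)) :
    morphismDegree f = Module.finrank K L := by
  let := (functionFieldMap f).hom.toAlgebra
  exact (Algebra.finrank_eq_of_equiv_equiv e₁ e₂ h).symm

lemma morphismDegree_comp_of_isIso {X Y Z : Scheme.{u}} [IsIntegral X] [IsIntegral Y]
    [IsIntegral Z] (f : X ⟶ Y) (g : Y ⟶ Z) [IsDominant f] [IsIso g] :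
    morphismDegree (f ≫ g) = morphismDegree f := by
  let := (functionFieldMap f).hom.toAlgebra
  refine morphismDegree_eq_finrank (f ≫ g)
    (asIso (functionFieldMap g)).commRingCatIsoToRingEquiv.symm (RingEquiv.refl _) ?_
  rw [functionFieldMap_comp]
  ext x
  change functionFieldMap f (functionFieldMap g (inv (functionFieldMap g) x)) =
    functionFieldMap f x
  exact congr(functionFieldMap f ($(IsIso.inv_hom_id (functionFieldMap g)) x))

end FunctionFieldMap

/-! ### Evaluation of sections at points given by morphisms from a spectrum. -/

section FieldValuedPoint

/-- Evaluation of sections at a point with values in `L`. -/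
noncomputable def evalAtPoint {X : Scheme.{u}} {L : CommRingCat.{u}} (q : Spec L ⟶ X) (U : X.Opens)
    (h : ⊤ ≤ q ⁻¹ᵁ U) : Γ(X, U) ⟶ L :=
  q.appLE U ⊤ h ≫ (Scheme.ΓSpecIso L).hom

lemma evalAtPoint_comp {X Y : Scheme.{u}} {L : CommRingCat.{u}} (q : Spec L ⟶ X) (f : X ⟶ Y)
    (U : Y.Opens) (h : ⊤ ≤ (q ≫ f) ⁻¹ᵁ U) :
    evalAtPoint (q ≫ f) U h = f.app U ≫ evalAtPoint q (f ⁻¹ᵁ U) h := by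
  have h1 : f.app U ≫ q.appLE (f ⁻¹ᵁ U) ⊤ h = (q ≫ f).appLE U ⊤ h := by
    rw [Scheme.Hom.app_eq_appLE]
    exact Scheme.Hom.appLE_comp_appLE ..
  simp only [evalAtPoint, reassoc_of% h1]

lemma evalAtPoint_SpecMap_comp {X : Scheme.{u}} {K L : CommRingCat.{u}} (q : Spec K ⟶ X)
    (g : K ⟶ L) (U : X.Opens) (h : ⊤ ≤ q ⁻¹ᵁ U) (h' : ⊤ ≤ (Spec.map g ≫ q) ⁻¹ᵁ U) :
    evalAtPoint (Spec.map g ≫ q) U h' = evalAtPoint q U h ≫ g := by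
  have h1 : q.appLE U ⊤ h ≫ (Spec.map g).appTop = (Spec.map g ≫ q).appLE U ⊤ h' := by
    rw [Scheme.Hom.appTop, Scheme.Hom.app_eq_appLE]
    exact Scheme.Hom.appLE_comp_appLE ..
  simp only [evalAtPoint, Category.assoc]
  rw [← Scheme.ΓSpecIso_naturality, reassoc_of% h1]

lemma Scheme.presheaf_map_eq_id (X : Scheme.{u}) {U : X.Opens} (f : Opposite.op U ⟶ Opposite.op U) :
    X.presheaf.map f = 𝟙 _ := by
  rw [Subsingleton.elim f (𝟙 _), X.presheaf.map_id]

lemma evalAtPoint_fromSpecStalk {X : Scheme.{u}} {x : X} {U : X.Opens} (hx : x ∈ U)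
    (h : ⊤ ≤ (X.fromSpecStalk x) ⁻¹ᵁ U) :
    evalAtPoint (X.fromSpecStalk x) U h = X.presheaf.germ U x hx := by
  rw [evalAtPoint, Scheme.Hom.appLE, Scheme.fromSpecStalk_app hx]
  simp only [Category.assoc, ← Functor.map_comp_assoc]
  erw [Scheme.presheaf_map_eq_id, Category.id_comp]
  simp

lemma evalAtPoint_fromSpec {X : Scheme.{u}} {U : X.Opens} (hU : IsAffineOpen U)
    (h : ⊤ ≤ hU.fromSpec ⁻¹ᵁ U) : evalAtPoint hU.fromSpec U h = 𝟙 _ := by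
  rw [evalAtPoint, Scheme.Hom.appLE, hU.fromSpec_app_self]
  simp only [Category.assoc, ← Functor.map_comp_assoc]
  erw [Scheme.presheaf_map_eq_id, Category.id_comp]
  simp

lemma top_le_preimage_fromSpecFunctionField {X : Scheme.{u}} [IsIntegral X] (U : X.Opens)
    [hU : Nonempty U] : ⊤ ≤ (fromSpecFunctionField X) ⁻¹ᵁ U := by
  intro y _
  have : fromSpecFunctionField X y ⤳ genericPoint X := by
    have h := Scheme.range_fromSpecStalk (X := X) (x := genericPoint X)
    have h2 : fromSpecFunctionField X y ∈ Set.range (X.fromSpecStalk (genericPoint X)) := ⟨y, rfl⟩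
    rw [h] at h2
    exact h2
  exact this.mem_open U.2
    (((genericPoint_spec X).mem_open_set_iff U.isOpen).mpr (by simpa using hU))

lemma evalAtPoint_fromSpecFunctionField {X : Scheme.{u}} [IsIntegral X] (U : X.Opens)
    [Nonempty U] (h : ⊤ ≤ (fromSpecFunctionField X) ⁻¹ᵁ U) :
    evalAtPoint (fromSpecFunctionField X) U h = X.germToFunctionField U :=
  evalAtPoint_fromSpecStalk _ _

lemma germToFunctionField_functionFieldMap {X Y : Scheme.{u}} [IsIntegral X] [IsIntegral Y]
    (f : X ⟶ Y) [IsDominant f] (U : Y.Opens) [Nonempty U] [Nonempty (f ⁻¹ᵁ U)] :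
    Y.germToFunctionField U ≫ functionFieldMap f =
      f.app U ≫ X.germToFunctionField (f ⁻¹ᵁ U) := by
  have h : ⊤ ≤ (Spec.map (functionFieldMap f) ≫ fromSpecFunctionField Y) ⁻¹ᵁ U := by
    rw [SpecMap_functionFieldMap_fromSpecFunctionField]
    exact top_le_preimage_fromSpecFunctionField (f ⁻¹ᵁ U)
  have h1 := evalAtPoint_SpecMap_comp (fromSpecFunctionField Y) (functionFieldMap f) U
    (top_le_preimage_fromSpecFunctionField U) h
  rw [evalAtPoint_fromSpecFunctionField] at h1
  rw [← h1, ← evalAtPoint_fromSpecFunctionField (f ⁻¹ᵁ U) (top_le_preimage_fromSpecFunctionField _)]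
  simp only [SpecMap_functionFieldMap_fromSpecFunctionField]
  exact evalAtPoint_comp (fromSpecFunctionField X) f U
    (top_le_preimage_fromSpecFunctionField (f ⁻¹ᵁ U))

end FieldValuedPoint

/-! ### Relative normalisation: sections and universal property. -/

section Normalization

/-- The sections of the normalisation over an affine open are the elements integral over the
sections of the base. -/
lemma Scheme.Hom.evalAtPoint_toNormalization {X : Scheme.{u}} {L : CommRingCat.{u}} (q : Spec L ⟶ X)
    [QuasiCompact q] [QuasiSeparated q] {U : X.Opens} (hU : IsAffineOpen U) (h : ⊤ ≤ q ⁻¹ᵁ U)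
    (h' : ⊤ ≤ q.toNormalization ⁻¹ᵁ q.fromNormalization ⁻¹ᵁ U) :
    Function.Injective (evalAtPoint q.toNormalization (q.fromNormalization ⁻¹ᵁ U) h') ∧
    ∀ l : L, (evalAtPoint q U h).hom.IsIntegralElem l ↔
      ∃ d, evalAtPoint q.toNormalization (q.fromNormalization ⁻¹ᵁ U) h' d = l := by
  let := (q.app U).hom.toAlgebra
  have hval := q.normalizationObjIso_hom_val hU
  have htop : q ⁻¹ᵁ U = ⊤ := top_le_iff.mp h
  let e : Γ(Spec L, q ⁻¹ᵁ U) ≅ L :=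
    (Spec L).presheaf.mapIso (eqToIso htop.symm).op ≪≫ Scheme.ΓSpecIso L
  have h1 : evalAtPoint q.toNormalization (q.fromNormalization ⁻¹ᵁ U) h' =
      (q.normalizationObjIso hU).hom ≫ CommRingCat.ofHom (Subalgebra.val _).toRingHom ≫ e.hom := by
    rw [reassoc_of% hval, evalAtPoint]
    simp only [e, Iso.trans_hom, Functor.mapIso_hom, Iso.op_hom, eqToIso.hom,
      Scheme.Hom.appLE_map_assoc]
  have h2 : evalAtPoint q U h = q.app U ≫ e.hom := by
    rw [evalAtPoint, Scheme.Hom.appLE, Category.assoc]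
    rfl
  have hval' : ∀ d, evalAtPoint q.toNormalization (q.fromNormalization ⁻¹ᵁ U) h' d =
      e.hom ((q.normalizationObjIso hU).hom d).1 := fun d ↦ by rw [h1]; rfl
  refine ⟨fun a b hab ↦ ?_, fun l ↦ ?_⟩
  · rw [hval', hval'] at hab
    exact (q.normalizationObjIso hU).commRingCatIsoToRingEquiv.injective
      (Subtype.ext (e.commRingCatIsoToRingEquiv.injective hab))
  · rw [h2]
    constructor
    · rintro ⟨p, hp, hpl⟩
      have hint : _root_.IsIntegral Γ(X, U) (e.inv l) := by
        refine ⟨p, hp, e.commRingCatIsoToRingEquiv.injective ?_⟩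
        rw [map_zero, ← hpl]
        change e.hom.hom (Polynomial.eval₂ _ _ p) = _
        rw [Polynomial.hom_eval₂]
        congr 1
        exact congr($(e.inv_hom_id) l)
      refine ⟨(q.normalizationObjIso hU).inv ⟨e.inv l, hint⟩, ?_⟩
      rw [hval', ← CommRingCat.comp_apply, Iso.inv_hom_id]
      exact congr($(e.inv_hom_id) l)
    · rintro ⟨d, rfl⟩
      rw [hval']
      obtain ⟨p, hp, hpl⟩ := ((q.normalizationObjIso hU).hom d).2
      refine ⟨p, hp, ?_⟩
      rw [CommRingCat.hom_comp, ← Polynomial.hom_eval₂]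
      exact (congrArg e.hom.hom hpl).trans (map_zero _)

/-- If `T ⟶ Y` is integral and `T` is normal in `W`, then `T` is the normalisation of `Y` in `W`. -/
lemma Scheme.Hom.isIso_normalizationDesc {W T Y : Scheme.{u}} (f : W ⟶ Y) (q : W ⟶ T) (g : T ⟶ Y)
    [QuasiCompact f] [QuasiSeparated f] [QuasiCompact q] [QuasiSeparated q] [IsIntegralHom g]
    [IsIso q.fromNormalization] (H : f = q ≫ g) : IsIso (f.normalizationDesc q g H) := by
  set d := f.normalizationDesc q g H
  -- The inverse comes from the universal property of the normalisation of T in W, which is T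
  -- itself.
  let e : q.normalization ⟶ f.normalization :=
    q.normalizationDesc f.toNormalization d (f.toNormalization_normalizationDesc q g H).symm
  have he : e ≫ d = q.fromNormalization := q.normalizationDesc_comp ..
  have hd : d ≫ g = f.fromNormalization := f.normalizationDesc_comp ..
  refine ⟨inv q.fromNormalization ≫ e, ?_, ?_⟩
  · refine Scheme.Hom.normalization.hom_ext _ _ _ f.fromNormalization ?_ ?_ (Category.id_comp _)
    · rw [f.toNormalization_normalizationDesc_assoc q g H, Category.comp_id]
      have : q ≫ inv q.fromNormalization = q.toNormalization := by
        rw [IsIso.comp_inv_eq, q.toNormalization_fromNormalization]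
      rw [reassoc_of% this]
      exact q.toNormalization_normalizationDesc ..
    · rw [← hd, Category.assoc, Category.assoc, reassoc_of% he, IsIso.inv_hom_id_assoc]
  · rw [Category.assoc, he, IsIso.inv_hom_id]

end Normalization


/-! ### Normality tested on affine opens. -/

section NormalScheme

lemma IsNormalScheme.isIntegrallyClosed {X : Scheme.{u}} [IsIntegral X] (hX : IsNormalScheme X)
    {U : X.Opens} (hU : IsAffineOpen U) [Nonempty U] : IsIntegrallyClosed Γ(X, U) := by
  refine IsIntegrallyClosed.of_localization_maximal fun P _ hP ↦ ?_
  let y : PrimeSpectrum Γ(X, U) := ⟨P, hP.isPrime⟩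
  have hmem : hU.fromSpec y ∈ U := by
    have : hU.fromSpec y ∈ Set.range hU.fromSpec := ⟨y, rfl⟩
    rwa [hU.range_fromSpec] at this
  let := TopCat.Presheaf.algebra_section_stalk X.presheaf ⟨hU.fromSpec y, hmem⟩
  have : IsLocalization.AtPrime (X.presheaf.stalk (hU.fromSpec y)) P :=
    hU.isLocalization_stalk' y hmem
  have := (hX (hU.fromSpec y)).2
  exact .of_equiv (IsLocalization.algEquiv P.primeCompl (X.presheaf.stalk (hU.fromSpec y))
    (Localization.AtPrime P)).toRingEquiv

lemma isNormalScheme_of_forall_exists {X : Scheme.{u}} [IsIntegral X]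
    (H : ∀ x : X, ∃ U : X.Opens, IsAffineOpen U ∧ x ∈ U ∧ IsIntegrallyClosed Γ(X, U)) :
    IsNormalScheme X := by
  intro x
  obtain ⟨U, hU, hx, _⟩ := H x
  have : Nonempty U := ⟨⟨x, hx⟩⟩
  let := TopCat.Presheaf.algebra_section_stalk X.presheaf ⟨x, hx⟩
  have : IsLocalization.AtPrime (X.presheaf.stalk x) (hU.primeIdealOf ⟨x, hx⟩).asIdeal :=
    hU.isLocalization_stalk ⟨x, hx⟩
  exact ⟨inferInstance, isIntegrallyClosed_of_isLocalization (R := Γ(X, U)) _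
    (hU.primeIdealOf ⟨x, hx⟩).asIdeal.primeCompl (Ideal.primeCompl_le_nonZeroDivisors _)⟩

end NormalScheme

/-! ### Normalisation in an extension of the function field. -/

section FunctionFieldExtension

variable {X : Scheme.{u}} [IsIntegral X] {L : CommRingCat.{u}} (g : X.functionField ⟶ L)

/-- The point of `X` with values in an extension of the function field. -/
noncomputable def genericFieldPoint : Spec L ⟶ X := Spec.map g ≫ fromSpecFunctionField X

lemma top_le_preimage_genericFieldPoint (U : X.Opens) [Nonempty U] :
    ⊤ ≤ (genericFieldPoint g) ⁻¹ᵁ U := by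
  intro y _
  exact top_le_preimage_fromSpecFunctionField U trivial

lemma evalAtPoint_genericFieldPoint (U : X.Opens) [Nonempty U]
    (h : ⊤ ≤ (genericFieldPoint g) ⁻¹ᵁ U) :
    evalAtPoint (genericFieldPoint g) U h = X.germToFunctionField U ≫ g := by
  rw [← evalAtPoint_fromSpecFunctionField U (top_le_preimage_fromSpecFunctionField U)]
  exact evalAtPoint_SpecMap_comp ..

instance isDominant_genericFieldPoint [Nontrivial L] : IsDominant (genericFieldPoint g) := by
  have : Nonempty (Spec L) := inferInstanceAs (Nonempty (PrimeSpectrum L))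
  obtain ⟨y⟩ := this
  refine ⟨dense_iff_inter_open.mpr fun U hU hne ↦ ?_⟩
  have : Nonempty (⟨U, hU⟩ : X.Opens) := hne.to_subtype
  exact ⟨_, top_le_preimage_genericFieldPoint g ⟨U, hU⟩ (Set.mem_univ y), y, rfl⟩

instance quasiCompact_genericFieldPoint : QuasiCompact (genericFieldPoint g) := by
  unfold genericFieldPoint
  infer_instance

instance quasiSeparated_genericFieldPoint : QuasiSeparated (genericFieldPoint g) := by
  unfold genericFieldPoint
  infer_instance

/-- The sections over `U` of the normalisation in `L`, as elements of `L`. -/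
noncomputable def normalizationEval (U : X.Opens) [Nonempty U] :
    Γ((genericFieldPoint g).normalization, (genericFieldPoint g).fromNormalization ⁻¹ᵁ U) →+* L :=
  (evalAtPoint (genericFieldPoint g).toNormalization _ (by
    rw [← Scheme.Hom.comp_preimage, Scheme.Hom.toNormalization_fromNormalization]
    exact top_le_preimage_genericFieldPoint _ U)).hom

lemma normalizationEval_comp (U : X.Opens) [Nonempty U] :
    (normalizationEval g U).comp ((genericFieldPoint g).fromNormalization.app U).hom =
      g.hom.comp (X.germToFunctionField U).hom := by
  have h := top_le_preimage_genericFieldPoint g U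
  have h1 := evalAtPoint_genericFieldPoint g U h
  have h2 := evalAtPoint_comp (genericFieldPoint g).toNormalization
    (genericFieldPoint g).fromNormalization U (by
      rwa [Scheme.Hom.toNormalization_fromNormalization])
  simp only [Scheme.Hom.toNormalization_fromNormalization] at h2
  rw [h1] at h2
  exact congr(($h2).hom).symm

lemma normalizationEval_injective {U : X.Opens} (hU : IsAffineOpen U) [Nonempty U] :
    Function.Injective (normalizationEval g U) :=
  (Scheme.Hom.evalAtPoint_toNormalization (genericFieldPoint g) hU
    (top_le_preimage_genericFieldPoint _ U) _).1

lemma exists_normalizationEval_eq_iff {U : X.Opens} (hU : IsAffineOpen U) [Nonempty U] (l : L) :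
    (∃ d, normalizationEval g U d = l) ↔
      (g.hom.comp (X.germToFunctionField U).hom).IsIntegralElem l := by
  have h := (Scheme.Hom.evalAtPoint_toNormalization (genericFieldPoint g) hU
    (top_le_preimage_genericFieldPoint _ U) (by
      rw [← Scheme.Hom.comp_preimage, Scheme.Hom.toNormalization_fromNormalization]
      exact top_le_preimage_genericFieldPoint _ U)).2 l
  rw [evalAtPoint_genericFieldPoint] at h
  exact h.symm

end FunctionFieldExtension

/-! ### Integral closures described by ring homomorphisms. -/

section IntegralClosure

/-- `H` says that ε identifies D with the integral closure of A in L. As g identifies L with the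
fraction field, normality leaves only A. -/
lemma bijective_of_forall_isIntegralElem {A K L D : Type*} [CommRing A] [IsIntegrallyClosed A]
    [Field K] [Algebra A K] [IsFractionRing A K] [CommRing L] [CommRing D]
    {φ : A →+* D} {ε : D →+* L} {g : K →+* L} (hg : Function.Bijective g)
    (hε : Function.Injective ε)
    (h : ε.comp φ = g.comp (algebraMap A K))
    (H : ∀ l, (∃ d, ε d = l) ↔ (g.comp (algebraMap A K)).IsIntegralElem l) :
    Function.Bijective φ := by
  have heval (a) : ε (φ a) = g (algebraMap A K a) := congr($h a)
  refine ⟨fun a b hab ↦ IsFractionRing.injective A K (hg.1 ?_), fun d ↦ ?_⟩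
  · rw [← heval, hab, heval]
  · obtain ⟨y, hy⟩ := hg.2 (ε d)
    obtain ⟨p, hp, hpy⟩ := (H _).mp ⟨d, rfl⟩
    have hint : _root_.IsIntegral A y := by
      refine ⟨p, hp, hg.1 ?_⟩
      rw [Polynomial.hom_eval₂, map_zero, hy, hpy]
    obtain ⟨a, rfl⟩ := IsIntegrallyClosed.isIntegral_iff.mp hint
    exact ⟨a, hε ((heval a).trans hy)⟩

variable {A K L D : Type*} [CommRing A] [IsDomain A] [Field K] [Algebra A K] [IsFractionRing A K]
  [Field L] [Algebra K L] [FiniteDimensional K L] [CommRing D]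
  {φ : A →+* D} {ε : D →+* L}


/-- The hypotheses say that D is the integral closure of A in L. They use bare ring maps because
section rings of a normalisation come in this form. -/
lemma isFractionRing_of_forall_isIntegralElem (hε : Function.Injective ε)
    (h : ε.comp φ = (algebraMap K L).comp (algebraMap A K))
    (H : ∀ l, (∃ d, ε d = l) ↔ ((algebraMap K L).comp (algebraMap A K)).IsIntegralElem l) :
    letI := ε.toAlgebra; IsFractionRing D L := by
  algebraize [ε, φ, (algebraMap K L).comp (algebraMap A K)]
  have : IsScalarTower A D L := .of_algebraMap_eq' h.symm
  have : IsDomain D := hε.isDomain ε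
  have : IsIntegralClosure D A L := ⟨hε, fun {l} ↦ (H l).symm⟩
  exact IsIntegralClosure.isFractionRing_of_finite_extension A K L D

lemma isIntegrallyClosed_of_forall_isIntegralElem (hε : Function.Injective ε)
    (h : ε.comp φ = (algebraMap K L).comp (algebraMap A K))
    (H : ∀ l, (∃ d, ε d = l) ↔ ((algebraMap K L).comp (algebraMap A K)).IsIntegralElem l) :
    IsIntegrallyClosed D := by
  algebraize [ε, φ, (algebraMap K L).comp (algebraMap A K)]
  have : IsScalarTower A D L := .of_algebraMap_eq' h.symm
  have : IsIntegralClosure D A L := ⟨hε, fun {l} ↦ (H l).symm⟩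
  have := integralClosure.isIntegrallyClosedOfFiniteExtension (R := A) K (L := L)
  exact .of_equiv (IsIntegralClosure.equiv A (integralClosure A L) L D).toRingEquiv

lemma finite_of_forall_isIntegralElem [IsIntegrallyClosed A] [IsNoetherianRing A]
    [Algebra.IsSeparable K L] (hε : Function.Injective ε)
    (h : ε.comp φ = (algebraMap K L).comp (algebraMap A K))
    (H : ∀ l, (∃ d, ε d = l) ↔ ((algebraMap K L).comp (algebraMap A K)).IsIntegralElem l) :
    φ.Finite := by
  algebraize [ε, φ, (algebraMap K L).comp (algebraMap A K)]
  have : IsScalarTower A D L := .of_algebraMap_eq' h.symm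
  have : IsIntegralClosure D A L := ⟨hε, fun {l} ↦ (H l).symm⟩
  exact IsIntegralClosure.finite A K L D

end IntegralClosure

/-! ### Normality, finiteness and degree of the normalisation in L. -/

section NormalizationInField

variable {X : Scheme.{u}} [IsIntegral X] (L : Type u) [Field L] [Algebra X.functionField L]

/-- The structure map of an extension of the function field, as a morphism. -/
noncomputable abbrev functionFieldExtension : X.functionField ⟶ CommRingCat.of L :=
  CommRingCat.ofHom (algebraMap X.functionField L)

/-- The point of `X` with values in an extension `L` of the function field. -/
noncomputable abbrev fieldPoint : Spec (.of L) ⟶ X :=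
  genericFieldPoint (functionFieldExtension L)

instance isDominant_fromNormalization : IsDominant (fieldPoint (X := X) L).fromNormalization := by
  have : Nontrivial (CommRingCat.of L) := inferInstanceAs (Nontrivial L)
  have : IsDominant
      ((fieldPoint (X := X) L).toNormalization ≫ (fieldPoint L).fromNormalization) := by
    rw [Scheme.Hom.toNormalization_fromNormalization]
    exact isDominant_genericFieldPoint _
  exact .of_comp (fieldPoint (X := X) L).toNormalization _

variable [FiniteDimensional X.functionField L]

lemma isNormalScheme_normalization : IsNormalScheme (fieldPoint (X := X) L).normalization := by
  refine isNormalScheme_of_forall_exists fun x ↦ ?_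
  obtain ⟨U, hU, hx, -⟩ := exists_isAffineOpen_mem_and_subset
    (x := (fieldPoint (X := X) L).fromNormalization x) (U := ⊤) trivial
  have : Nonempty U := ⟨⟨_, hx⟩⟩
  have := functionField_isFractionRing_of_isAffineOpen X U hU
  exact ⟨_, hU.preimage _, hx, isIntegrallyClosed_of_forall_isIntegralElem
    (normalizationEval_injective (functionFieldExtension L) hU)
    (normalizationEval_comp (functionFieldExtension L) U)
    (exists_normalizationEval_eq_iff (functionFieldExtension L) hU)⟩

/-- Separability enters here: over a normal noetherian ring it makes the integral closure in L a
finite module. -/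
lemma isFinite_fromNormalization [IsLocallyNoetherian X] (hX : IsNormalScheme X)
    [Algebra.IsSeparable X.functionField L] :
    IsFinite (fieldPoint (X := X) L).fromNormalization where
  finite_app U hU := by
    by_cases hU' : Nonempty U
    · have := functionField_isFractionRing_of_isAffineOpen X U hU
      have := hX.isIntegrallyClosed hU
      have : IsNoetherianRing Γ(X, U) := IsLocallyNoetherian.component_noetherian ⟨U, hU⟩
      exact finite_of_forall_isIntegralElem
        (normalizationEval_injective (functionFieldExtension L) hU)
        (normalizationEval_comp (functionFieldExtension L) U)
        (exists_normalizationEval_eq_iff (functionFieldExtension L) hU)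
    -- The empty open has no function field to work in, but its sections form the zero ring.
    · have hbot : U = ⊥ := by
        ext x
        exact ⟨fun hx ↦ (hU' ⟨⟨x, hx⟩⟩).elim, fun hx ↦ hx.elim⟩
      subst hbot
      have : Subsingleton Γ((fieldPoint (X := X) L).normalization,
          (fieldPoint (X := X) L).fromNormalization ⁻¹ᵁ ⊥) :=
        inferInstanceAs (Subsingleton Γ((fieldPoint (X := X) L).normalization, ⊥))
      exact .of_surjective _ fun x ↦ ⟨0, Subsingleton.elim _ _⟩

lemma isFractionRing_normalizationEval {U : X.Opens} (hU : IsAffineOpen U) [Nonempty U] :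
    letI := (normalizationEval (functionFieldExtension L) U).toAlgebra
    IsFractionRing Γ((fieldPoint (X := X) L).normalization,
      (fieldPoint L).fromNormalization ⁻¹ᵁ U) L :=
  have := functionField_isFractionRing_of_isAffineOpen X U hU
  isFractionRing_of_forall_isIntegralElem
    (normalizationEval_injective (functionFieldExtension L) hU)
    (normalizationEval_comp _ U) (exists_normalizationEval_eq_iff (functionFieldExtension L) hU)

/-- Over a nonempty affine open, both L and the function field of the normalisation are fraction
fields of the same ring of sections. -/
lemma morphismDegree_fromNormalization :
    morphismDegree (fieldPoint (X := X) L).fromNormalization =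
      Module.finrank X.functionField L := by
  obtain ⟨U, hU, hx, -⟩ := exists_isAffineOpen_mem_and_subset
    (x := genericPoint X) (U := ⊤) trivial
  set ρ := (fieldPoint (X := X) L).fromNormalization
  have hne : Nonempty U := ⟨⟨_, hx⟩⟩
  have : Nonempty (ρ ⁻¹ᵁ U) := by
    obtain ⟨y, hy⟩ := ρ.denseRange.exists_mem_open U.isOpen ⟨_, hx⟩
    exact ⟨⟨y, hy⟩⟩
  have := functionField_isFractionRing_of_isAffineOpen X U hU
  have := functionField_isFractionRing_of_isAffineOpen _ _ (hU.preimage ρ)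
  let := (normalizationEval (functionFieldExtension L) U).toAlgebra
  have : IsFractionRing Γ((fieldPoint (X := X) L).normalization, ρ ⁻¹ᵁ U) L :=
    isFractionRing_normalizationEval L hU
  let e := IsLocalization.algEquiv (nonZeroDivisors Γ((fieldPoint (X := X) L).normalization,
    ρ ⁻¹ᵁ U)) L (fieldPoint (X := X) L).normalization.functionField
  refine morphismDegree_eq_finrank ρ (RingEquiv.refl _) e.toRingEquiv ?_
  refine IsLocalization.ringHom_ext (nonZeroDivisors Γ(X, U)) ?_
  ext a
  have h1 := congr($(germToFunctionField_functionFieldMap ρ U) a)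
  have h2 := congr(e ($(normalizationEval_comp (functionFieldExtension L) U) a))
  exact h1.trans ((e.commutes (ρ.app U a)).symm.trans h2)

end NormalizationInField

/-! ### Recognising normalisations. -/

section IsNormalisation

variable {Z : Scheme.{u}} [IsIntegral Z] {L : CommRingCat.{u}} (g : Z.functionField ⟶ L) [IsIso g]

/-- A normal scheme is its own normalisation. -/
lemma IsNormalScheme.isIso_fromNormalization (hZ : IsNormalScheme Z) :
    IsIso (genericFieldPoint g).fromNormalization := by
  refine IsZariskiLocalAtTarget.of_forall_exists_morphismRestrict (P := .isomorphisms _) fun x ↦ ?_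
  obtain ⟨U, hU, hx, -⟩ := exists_isAffineOpen_mem_and_subset (x := x) (U := ⊤) trivial
  refine ⟨U, hx, (isIso_morphismRestrict_iff_isIso_app _ hU).mpr ?_⟩
  have : Nonempty U := ⟨⟨_, hx⟩⟩
  have := hZ.isIntegrallyClosed hU
  have := functionField_isFractionRing_of_isAffineOpen Z U hU
  exact (ConcreteCategory.isIso_iff_bijective _).mpr (bijective_of_forall_isIntegralElem
    (ConcreteCategory.bijective_of_isIso g) (normalizationEval_injective g hU)
    (normalizationEval_comp g U) (exists_normalizationEval_eq_iff g hU))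

end IsNormalisation

section IsNormalisation

variable {Z Y : Scheme.{u}} [IsIntegral Z] [IsIntegral Y]

/-- An integral birational morphism from a normal scheme is the normalisation. -/
lemma IsNormalScheme.isNormalisation (hZ : IsNormalScheme Z) (ν : Z ⟶ Y) [IsIntegralHom ν]
    (g : Z.functionField ⟶ Y.functionField) [IsIso g]
    (H : fromSpecFunctionField Y = genericFieldPoint g ≫ ν) : IsNormalisation ν := by
  have := hZ.isIso_fromNormalization g
  have := Scheme.Hom.isIso_normalizationDesc _ _ _ H
  exact ⟨(asIso ((fromSpecFunctionField Y).normalizationDesc (genericFieldPoint g) ν H)).symm,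
    by simp⟩

lemma IsNormalScheme.isNormalisation_id (hZ : IsNormalScheme Z) : IsNormalisation (𝟙 Z) :=
  hZ.isNormalisation _ (𝟙 _) (by simp [genericFieldPoint])

end IsNormalisation


/-! ### Scheme-theoretic images of integral schemes. -/

section Image

lemma isSchemeTheoreticallyDominant_toImage {X Y : Scheme.{u}} (f : X ⟶ Y) [QuasiCompact f] :
    IsSchemeTheoreticallyDominant f.toImage := by
  rw [isSchemeTheoreticallyDominant_iff]
  refine Scheme.IdealSheafData.ext_of_iSup_eq_top
    (fun U : Y.affineOpens ↦ ⟨f.imageι ⁻¹ᵁ U.1, U.2.preimage _⟩)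
    (TopologicalSpace.IsOpenCover.comap (iSup_affineOpens_eq_top _) _) fun U ↦ ?_
  simp only [Scheme.Hom.ker_apply, Scheme.IdealSheafData.ideal_bot, Pi.bot_apply]
  rw [← RingHom.injective_iff_ker_eq_bot]
  exact f.toImage_app_injective U

lemma isIntegral_image {X Y : Scheme.{u}} [IsIntegral X] (f : X ⟶ Y) [QuasiCompact f] :
    IsIntegral f.image := by
  have := isSchemeTheoreticallyDominant_toImage f
  have := IsSchemeTheoreticallyDominant.isReduced f.toImage
  have : IrreducibleSpace f.image := by
    have h := ((IrreducibleSpace.isIrreducible_univ X).image _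
      f.toImage.continuous.continuousOn).closure
    rw [Set.image_univ, f.toImage.denseRange.closure_range] at h
    exact (irreducibleSpace_def _).mpr h
  exact isIntegral_of_irreducibleSpace_of_isReduced _

end Image

section FieldValuedPoint

/-- A dominant point with values in a field comes from an extension of the function field. -/
lemma exists_eq_genericFieldPoint {Y : Scheme.{u}} [IsIntegral Y] {F : Type u} [Field F]
    (t : Spec (.of F) ⟶ Y) [IsDominant t] :
    ∃ h : Y.functionField ⟶ .of F, t = genericFieldPoint h := by
  have hsp : t (IsLocalRing.closedPoint F) ⤳ genericPoint Y := by
    have : Subsingleton (Spec (.of F)) := inferInstanceAs (Subsingleton (PrimeSpectrum F))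
    have h := t.denseRange.closure_range
    have hr : Set.range t = {t (IsLocalRing.closedPoint F)} :=
      Set.range_eq_singleton_iff.mpr fun y ↦ congrArg t (Subsingleton.elim _ _)
    rw [hr] at h
    exact specializes_iff_mem_closure.mpr (h ▸ Set.mem_univ _)
  refine ⟨Y.presheaf.stalkSpecializes hsp ≫ Scheme.stalkClosedPointTo t, ?_⟩
  rw [genericFieldPoint, Spec.map_comp, Category.assoc, fromSpecFunctionField,
    Scheme.SpecMap_stalkSpecializes_fromSpecStalk]
  exact (Scheme.Spec_stalkClosedPointTo_fromSpecStalk t).symm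

end FieldValuedPoint

/-! ### The closure of a field-valued point and its normalisation. -/

section ImageNormalisation

/-- If a field-valued point `s` of `N` with values in `K(St)` lies over the generic point of
`St ⟶ S ⟶ X` and its residue field is `K(St)`, then its closure has normalisation `St`. -/
theorem exists_isNormalisation_image {X S St N : Scheme.{u}} [IsIntegral S] [IsIntegral St]
    (i : S ⟶ X) [IsClosedImmersion i] (γ : St ⟶ S) [IsIntegralHom γ] [Surjective γ]
    (hSt : IsNormalScheme St) (ρ : N ⟶ X) [IsIntegralHom ρ] (s : Spec St.functionField ⟶ N)
    [QuasiCompact s] (hs : s ≫ ρ = fromSpecFunctionField St ≫ γ ≫ i) (V : N.Opens)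
    (hV : ⊤ ≤ s ⁻¹ᵁ V)
    (H : ∀ x : St.functionField, ∃ a b, evalAtPoint s V hV b * x = evalAtPoint s V hV a ∧
      evalAtPoint s V hV b ≠ 0) :
    ∃ (Sh : Scheme.{u}) (_ : IsIntegral Sh) (j : Sh ⟶ N) (_ : IsClosedImmersion j)
      (ν : St ⟶ Sh) (ρS : Sh ⟶ S), Surjective ρS ∧ j ≫ ρ = ρS ≫ i ∧ ν ≫ ρS = γ ∧
      IsNormalisation ν := by
  have : IsIntegral (Spec St.functionField) := inferInstance
  have hSh := isIntegral_image s
  set Sh := s.image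
  set j : Sh ⟶ N := s.imageι
  set t : Spec St.functionField ⟶ Sh := s.toImage
  have htj : t ≫ j = s := s.toImage_imageι
  obtain ⟨h, ht⟩ := exists_eq_genericFieldPoint (F := St.functionField) t
  -- the residue field of `s`
  have hVt : ⊤ ≤ (t ≫ j) ⁻¹ᵁ V := htj ▸ hV
  have : Nonempty (j ⁻¹ᵁ V) := ⟨⟨t (IsLocalRing.closedPoint St.functionField), hVt trivial⟩⟩
  have heval (a) : evalAtPoint s V hV a ∈ h.hom.range := by
    have h1 : evalAtPoint s V hV = evalAtPoint (t ≫ j) V hVt := by simp only [htj]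
    have h2 : evalAtPoint t (j ⁻¹ᵁ V) hVt = Sh.germToFunctionField (j ⁻¹ᵁ V) ≫ h := by
      rw [← evalAtPoint_genericFieldPoint h _ (top_le_preimage_genericFieldPoint h _)]
      simp only [ht]
    rw [evalAtPoint_comp, h2] at h1
    exact ⟨_, congr($h1 a).symm⟩
  -- Every element of K(St) is a quotient of values at s, and these values already come from K(Sh).
  have hbij : Function.Bijective h.hom := by
    refine ⟨h.hom.injective, fun x ↦ ?_⟩
    obtain ⟨a, b, hab, hb⟩ := H x
    obtain ⟨a', ha'⟩ := heval a
    obtain ⟨b', hb'⟩ := heval b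
    refine ⟨a' / b', ?_⟩
    rw [map_div₀, ha', hb', div_eq_iff hb, ← hab, mul_comm]
  have : IsIso h := (ConcreteCategory.isIso_iff_bijective h).mpr hbij
  -- the induced map to `S`
  have hcond : (fromSpecFunctionField St ≫ γ) ≫ i = t ≫ j ≫ ρ := by
    rw [reassoc_of% htj, hs, Category.assoc]
  -- The base change of i to Sh is a closed immersion through which the dominant t factors. It is
  -- therefore surjective, hence an isomorphism as Sh is reduced, and Sh → X factors through S.
  have : Surjective (Limits.pullback.snd i (j ≫ ρ)) := by
    have : IsDominant (Limits.pullback.lift (fromSpecFunctionField St ≫ γ) t hcond ≫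
        Limits.pullback.snd i (j ≫ ρ)) := by
      rw [Limits.pullback.lift_snd]
      infer_instance
    have : IsDominant (Limits.pullback.snd i (j ≫ ρ)) := .of_comp
      (Limits.pullback.lift (fromSpecFunctionField St ≫ γ) t hcond) _
    infer_instance
  have : IsIso (Limits.pullback.snd i (j ≫ ρ)) := isIso_of_isClosedImmersion_of_surjective _
  let ρS : Sh ⟶ S := inv (Limits.pullback.snd i (j ≫ ρ)) ≫ Limits.pullback.fst i (j ≫ ρ)
  have hρS : ρS ≫ i = j ≫ ρ := by
    rw [Category.assoc, Limits.pullback.condition, IsIso.inv_hom_id_assoc]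
  have htρS : fromSpecFunctionField St ≫ γ = t ≫ ρS := by
    rw [← cancel_mono i, hcond, Category.assoc, hρS]
  have : IsIntegralHom (ρS ≫ i) := hρS ▸ inferInstance
  have : IsIntegralHom ρS := .of_comp ρS i
  let q := genericFieldPoint (𝟙 St.functionField)
  have hq : q = fromSpecFunctionField St := by simp [q, genericFieldPoint]
  have : IsDominant (t ≫ ρS) := by
    rw [← htρS, ← hq]
    infer_instance
  have : IsDominant ρS := .of_comp t ρS
  have hS : Surjective ρS := inferInstance
  -- the normalisation map
  have := hSt.isIso_fromNormalization (𝟙 St.functionField)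
  have H1 : fromSpecFunctionField St ≫ γ = q ≫ γ := by rw [hq]
  have := Scheme.Hom.isIso_normalizationDesc _ _ _ H1
  set f := fromSpecFunctionField St ≫ γ
  -- The normalisation of S in K(St) maps to both St and Sh; the first map is invertible because St
  -- is normal.
  let ν : St ⟶ Sh := inv (f.normalizationDesc q γ H1) ≫ f.normalizationDesc t ρS htρS
  have hν : ν ≫ ρS = γ := by
    rw [Category.assoc, f.normalizationDesc_comp, IsIso.inv_comp_eq, f.normalizationDesc_comp]
  have hqν : q ≫ ν = t := by
    have : q ≫ inv (f.normalizationDesc q γ H1) = f.toNormalization := by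
      rw [IsIso.comp_inv_eq, f.toNormalization_normalizationDesc]
    rw [reassoc_of% this, f.toNormalization_normalizationDesc]
  have : IsIntegralHom (ν ≫ ρS) := hν ▸ inferInstance
  have : IsIntegralHom ν := .of_comp ν ρS
  refine ⟨Sh, hSh, j, inferInstance, ν, ρS, hS, hρS.symm, hν, hSt.isNormalisation ν (inv h) ?_⟩
  rw [genericFieldPoint, Category.assoc, ← hq, hqν, ht, genericFieldPoint, ← Spec.map_comp_assoc]
  simp

end ImageNormalisation


/-! ### From a residue map on the integral closure to a point of the normalisation. -/

section LiftPoint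

variable {X : Scheme.{u}} [IsIntegral X] (L : Type u) [Field L] [Algebra X.functionField L]

/-- A point of the integral closure of a local ring of `X` in `L` with values in a field `F`
gives an `F`-valued point of the normalisation of `X` in `L`, and its residue field is all of `F`
if the given point is surjective on `F`. -/
lemma exists_point_normalization (x : X) [Algebra (X.presheaf.stalk x) L]
    [IsScalarTower (X.presheaf.stalk x) X.functionField L] {F : CommRingCat.{u}} [Nontrivial F]
    (ψ : X.presheaf.stalk x ⟶ F) (φ : integralClosure (X.presheaf.stalk x) L →+* F)
    (hφ : Function.Surjective φ) (hφψ : φ.comp (algebraMap (X.presheaf.stalk x) _) = ψ.hom) :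
    ∃ (s : Spec F ⟶ (fieldPoint (X := X) L).normalization)
      (V : (fieldPoint (X := X) L).normalization.Opens) (hV : ⊤ ≤ s ⁻¹ᵁ V),
      s ≫ (fieldPoint L).fromNormalization = Spec.map ψ ≫ X.fromSpecStalk x ∧
      ∀ y : F, ∃ a b, evalAtPoint s V hV b * y = evalAtPoint s V hV a ∧
        evalAtPoint s V hV b ≠ 0 := by
  obtain ⟨U, hU, hx, -⟩ := exists_isAffineOpen_mem_and_subset (x := x) (U := ⊤) trivial
  have : Nonempty U := ⟨⟨x, hx⟩⟩
  set ρ := (fieldPoint (X := X) L).fromNormalization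
  let ε : Γ((fieldPoint (X := X) L).normalization, ρ ⁻¹ᵁ U) →+* L :=
    normalizationEval (functionFieldExtension L) U
  let := TopCat.Presheaf.algebra_section_stalk X.presheaf ⟨x, hx⟩
  have : IsLocalization.AtPrime (X.presheaf.stalk x) (hU.primeIdealOf ⟨x, hx⟩).asIdeal :=
    hU.isLocalization_stalk ⟨x, hx⟩
  let : Algebra Γ(X, U) L :=
    ((algebraMap X.functionField L).comp (algebraMap Γ(X, U) X.functionField)).toAlgebra
  have hgerm (a : Γ(X, U)) : algebraMap (X.presheaf.stalk x) L (X.presheaf.germ U x hx a) =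
      algebraMap Γ(X, U) L a := by
    rw [IsScalarTower.algebraMap_apply _ X.functionField L,
      Scheme.algebraMap_germ_eq_germToFunctionField]
    rfl
  have : IsScalarTower Γ(X, U) (X.presheaf.stalk x) L := .of_algebraMap_eq fun a ↦ (hgerm a).symm
  have hε (d) : IsIntegral (X.presheaf.stalk x) (ε d) := by
    have : IsIntegral Γ(X, U) (ε d) :=
      (exists_normalizationEval_eq_iff (functionFieldExtension L) hU _).mp ⟨d, rfl⟩
    exact this.tower_top
  let φD : Γ((fieldPoint (X := X) L).normalization, ρ ⁻¹ᵁ U) ⟶ F :=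
    CommRingCat.ofHom (φ.comp (ε.codRestrict (integralClosure (X.presheaf.stalk x) L) hε))
  have hρφ : ρ.app U ≫ φD = X.presheaf.germ U x hx ≫ ψ := by
    ext a
    refine Eq.trans ?_ congr($hφψ (X.presheaf.germ U x hx a))
    refine congrArg φ (Subtype.ext ?_)
    refine Eq.trans ?_ (hgerm a).symm
    exact congr($(normalizationEval_comp (functionFieldExtension L) U) a)
  have htop : ⊤ ≤ (hU.preimage ρ).fromSpec ⁻¹ᵁ (ρ ⁻¹ᵁ U) := by
    rw [IsAffineOpen.fromSpec_preimage_self]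
  have htop' : ⊤ ≤ (Spec.map φD ≫ (hU.preimage ρ).fromSpec) ⁻¹ᵁ (ρ ⁻¹ᵁ U) :=
    fun y _ ↦ htop (Set.mem_univ (Spec.map φD y))
  have heval : evalAtPoint (Spec.map φD ≫ (hU.preimage ρ).fromSpec) (ρ ⁻¹ᵁ U) htop' = φD := by
    refine (evalAtPoint_SpecMap_comp _ _ _ htop htop').trans ?_
    rw [evalAtPoint_fromSpec, Category.id_comp]
  refine ⟨Spec.map φD ≫ (hU.preimage ρ).fromSpec, ρ ⁻¹ᵁ U, htop', ?_, fun y ↦ ?_⟩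
  · rw [Category.assoc, ← IsAffineOpen.SpecMap_appLE_fromSpec ρ hU (hU.preimage ρ) le_rfl,
      ← Spec.map_comp_assoc, ← Scheme.Hom.app_eq_appLE, hρφ, Spec.map_comp, Category.assoc,
      ← hU.fromSpecStalk_eq_fromSpecStalk hx]
    rfl
  · rw [heval]
    obtain ⟨c, rfl⟩ := hφ y
    -- An element integral over the local ring becomes integral over Γ(X, U) after multiplication by
    -- some m invertible at x. This is why values in F are obtained as fractions of sections.
    obtain ⟨m, hm⟩ := IsIntegral.exists_multiple_integral_of_isLocalization
      (hU.primeIdealOf ⟨x, hx⟩).asIdeal.primeCompl (c : L) c.2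
    obtain ⟨d, hd⟩ := (exists_normalizationEval_eq_iff (functionFieldExtension L) hU _).mpr hm
    have hm' : φD (ρ.app U m) = φ (algebraMap _ _ (algebraMap Γ(X, U) (X.presheaf.stalk x) m)) :=
      congr($hρφ m).trans congr($hφψ (X.presheaf.germ U x hx m)).symm
    refine ⟨d, ρ.app U m, ?_, ?_⟩
    · rw [hm', ← map_mul]
      refine congrArg φ (Subtype.ext ?_)
      refine Eq.trans ?_ hd.symm
      rw [Submonoid.smul_def, Algebra.smul_def]
      exact congrArg (· * (c : L)) (hgerm m)
    · rw [hm']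
      exact (((IsLocalization.map_units (X.presheaf.stalk x) m).map (algebraMap _
        (integralClosure (X.presheaf.stalk x) L))).map φ).ne_zero

end LiftPoint


/-! ### Finite morphisms and the residue field at the generic point of S. -/

section FiniteMorphism

lemma finite_functionFieldMap {X Y : Scheme.{u}} [IsIntegral X] [IsIntegral Y] (f : X ⟶ Y)
    [IsDominant f] [IsFinite f] : (functionFieldMap f).hom.Finite := by
  obtain ⟨U, hU, hx, -⟩ := exists_isAffineOpen_mem_and_subset
    (x := genericPoint Y) (U := ⊤) trivial
  have : Nonempty U := ⟨⟨_, hx⟩⟩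
  have : Nonempty (f ⁻¹ᵁ U) := by
    obtain ⟨y, hy⟩ := f.denseRange.exists_mem_open U.isOpen ⟨_, hx⟩
    exact ⟨⟨y, hy⟩⟩
  have := functionField_isFractionRing_of_isAffineOpen Y U hU
  have := functionField_isFractionRing_of_isAffineOpen X _ (hU.preimage f)
  have h := germToFunctionField_functionFieldMap f U
  have hfin : (f.app U).hom.Finite := IsFinite.finite_app (f := f) U hU
  algebraize [(f.app U).hom, (functionFieldMap f).hom,
    (functionFieldMap f).hom.comp (Y.germToFunctionField U).hom]
  have : IsScalarTower Γ(Y, U) Γ(X, f ⁻¹ᵁ U) X.functionField := .of_algebraMap_eq' congr(($h).hom)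
  have : FaithfulSMul Γ(Y, U) Γ(X, f ⁻¹ᵁ U) := by
    rw [faithfulSMul_iff_algebraMap_injective]
    have : Function.Injective ((functionFieldMap f).hom.comp (Y.germToFunctionField U).hom) :=
      (functionFieldMap f).hom.injective.comp (Y.germToFunctionField_injective U)
    have h2 : (functionFieldMap f).hom.comp (Y.germToFunctionField U).hom =
      (X.germToFunctionField (f ⁻¹ᵁ U)).hom.comp (f.app U).hom := congr(($h).hom)
    rw [h2, RingHom.coe_comp] at this
    exact this.of_comp
  exact Module.Finite.of_isLocalization Γ(Y, U) Γ(X, f ⁻¹ᵁ U) (nonZeroDivisors Γ(Y, U))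

end FiniteMorphism

section SubvarietyPoint

variable {X S St : Scheme.{u}} [IsIntegral S] [IsIntegral St] (i : S ⟶ X) [IsClosedImmersion i]
  (γ : St ⟶ S)

/-- The map from the local ring of `X` at the generic point of `S` to the function field of a
scheme dominating `S`. -/
noncomputable def stalkToFunctionField [IsDominant γ] :
    X.presheaf.stalk (i (genericPoint S)) ⟶ St.functionField :=
  i.stalkMap (genericPoint S) ≫ functionFieldMap γ

omit [IsClosedImmersion i] in
lemma SpecMap_stalkToFunctionField_fromSpecStalk [IsDominant γ] :
    Spec.map (stalkToFunctionField i γ) ≫ X.fromSpecStalk (i (genericPoint S)) =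
      fromSpecFunctionField St ≫ γ ≫ i := by
  rw [stalkToFunctionField, Spec.map_comp, Category.assoc, Scheme.SpecMap_stalkMap_fromSpecStalk,
    ← SpecMap_functionFieldMap_fromSpecFunctionField_assoc]
  rfl

/-- The residue field of the generic point of `S` in `X` is the function field of `S`. -/
noncomputable def residueFieldEquiv :
    IsLocalRing.ResidueField (X.presheaf.stalk (i (genericPoint S))) ≃+* S.functionField :=
  RingEquiv.ofBijective (IsLocalRing.ResidueField.lift
    (S := S.functionField) (i.stalkMap (genericPoint S)).hom)
    ⟨RingHom.injective _, fun x ↦ by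
      obtain ⟨y, hy⟩ := i.stalkMap_surjective (genericPoint S) x
      exact ⟨IsLocalRing.residue _ y, hy⟩⟩

/-- The function field of `St` as an algebra over the residue field of the generic point of `S`. -/
noncomputable abbrev residueFieldAlgebra [IsDominant γ] :
    Algebra (IsLocalRing.ResidueField (X.presheaf.stalk (i (genericPoint S)))) St.functionField :=
  ((functionFieldMap γ).hom.comp
    (residueFieldEquiv i : IsLocalRing.ResidueField _ →+* S.functionField)).toAlgebra

lemma finite_residueFieldAlgebra [IsDominant γ] [IsFinite γ] :
    letI := residueFieldAlgebra i γ
    FiniteDimensional (IsLocalRing.ResidueField (X.presheaf.stalk (i (genericPoint S))))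
      St.functionField :=
  (finite_functionFieldMap γ).comp (.of_surjective _ (residueFieldEquiv i).surjective)

lemma morphismDegree_eq_finrank_residueField [IsDominant γ] :
    letI := residueFieldAlgebra i γ
    morphismDegree γ = Module.finrank
      (IsLocalRing.ResidueField (X.presheaf.stalk (i (genericPoint S)))) St.functionField := by
  let := residueFieldAlgebra i γ
  exact morphismDegree_eq_finrank γ (residueFieldEquiv i) (RingEquiv.refl _) rfl

end SubvarietyPoint

/-! ### The covering and the main theorem. -/

section Covering

variable {X S St : Scheme.{u}} [IsIntegral X] [IsIntegral S] [IsIntegral St] (i : S ⟶ X)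
  [IsClosedImmersion i] (γ : St ⟶ S) [IsFinite γ] [Surjective γ]

/-- An extension of the function field of `X` which realises the extension `K(St)` of the residue
field at the generic point of `S` gives a finite covering of `X` extending `St ⟶ S`. -/
theorem exists_finite_covering [IsLocallyNoetherian X] (hX : IsNormalScheme X)
    (hSt : IsNormalScheme St) (L : Type u) [Field L] [Algebra X.functionField L]
    [Algebra (X.presheaf.stalk (i (genericPoint S))) L]
    [IsScalarTower (X.presheaf.stalk (i (genericPoint S))) X.functionField L]
    [FiniteDimensional X.functionField L] [Algebra.IsSeparable X.functionField L]
    (hdeg : Module.finrank X.functionField L = morphismDegree γ)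
    (φ : integralClosure (X.presheaf.stalk (i (genericPoint S))) L →+* St.functionField)
    (hφ : Function.Surjective φ) (hφψ : φ.comp (algebraMap _ _) = (stalkToFunctionField i γ).hom) :
    ∃ (Xt : Scheme.{u}) (_ : IsIntegral Xt) (ρ : Xt ⟶ X) (_ : IsFinite ρ) (_ : Surjective ρ)
      (Sh : Scheme.{u}) (_ : IsIntegral Sh) (j : Sh ⟶ Xt) (_ : IsClosedImmersion j)
      (ν : St ⟶ Sh) (ρS : Sh ⟶ S),
      IsNormalScheme Xt ∧ Surjective ρS ∧ j ≫ ρ = ρS ≫ i ∧ ν ≫ ρS = γ ∧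
      IsNormalisation ν ∧ morphismDegree ρ = morphismDegree γ := by
  have hfin : IsFinite (fieldPoint (X := X) L).fromNormalization := isFinite_fromNormalization L hX
  have hsurj : Surjective (fieldPoint (X := X) L).fromNormalization := inferInstance
  obtain ⟨s, V, hV, hs, H⟩ := exists_point_normalization L (i (genericPoint S))
    (F := St.functionField) (stalkToFunctionField i γ) φ hφ hφψ
  rw [SpecMap_stalkToFunctionField_fromSpecStalk] at hs
  have : QuasiCompact s := by
    have : QuasiCompact (s ≫ (fieldPoint (X := X) L).fromNormalization) := by
      rw [hs]
      infer_instance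
    exact .of_comp s (fieldPoint (X := X) L).fromNormalization
  obtain ⟨Sh, hSh, j, hj, ν, ρS, h1, h2, h3, h4⟩ :=
    exists_isNormalisation_image i γ hSt _ s hs V hV H
  exact ⟨_, inferInstance, (fieldPoint (X := X) L).fromNormalization, hfin, hsurj, Sh, hSh, j, hj,
    ν, ρS, isNormalScheme_normalization L, h1, h2, h3, h4,
    (morphismDegree_fromNormalization L).trans hdeg⟩

omit [IsFinite γ] in
/-- If the local ring of `X` at the generic point of `S` is a field, then `S = X`. -/
lemma isIso_of_isField_stalk (h : IsField (X.presheaf.stalk (i (genericPoint S)))) : IsIso i := by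
  -- The points of the spectrum of the local ring are the generisations of its centre; a field
  -- leaves only one.
  have hx : i (genericPoint S) = genericPoint X := by
    have h1 : genericPoint X ∈ Set.range (X.fromSpecStalk (i (genericPoint S))) := by
      rw [Scheme.range_fromSpecStalk]
      exact (genericPoint_spec X).specializes trivial
    have h2 : i (genericPoint S) ∈ Set.range (X.fromSpecStalk (i (genericPoint S))) := by
      rw [Scheme.range_fromSpecStalk]
      exact specializes_rfl
    obtain ⟨a, ha⟩ := h1
    obtain ⟨b, hb⟩ := h2
    let := h.toField
    have : Subsingleton (Spec (X.presheaf.stalk (i (genericPoint S)))) :=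
      inferInstanceAs (Subsingleton (PrimeSpectrum (X.presheaf.stalk (i (genericPoint S)))))
    exact hb.symm.trans (congrArg _ (Subsingleton.elim b a) |>.trans ha)
  have : IsDominant i := by
    refine ⟨dense_iff_closure_eq.mpr (Set.eq_univ_of_univ_subset ?_)⟩
    rw [← (genericPoint_spec X).def, ← hx]
    exact closure_mono (Set.singleton_subset_iff.mpr ⟨_, rfl⟩)
  exact isIso_of_isClosedImmersion_of_surjective i

end Covering
theorem mainTheorem7 (k : Type u) [Field k]
    (X S St : Scheme.{u}) [IsIntegral S] [IsIntegral St]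
    (p : X ⟶ Spec (CommRingCat.of k)) (hX : IsVarietyOver p) (hXn : IsNormalScheme X)
    (i : S ⟶ X) [IsClosedImmersion i]
    (γ : St ⟶ S) [IsFinite γ] [Surjective γ]
    (hSt : IsVarietyOver (γ ≫ i ≫ p)) (hStn : IsNormalScheme St)
    (h : PerfectField (X.residueField (i (genericPoint S))) ∨
      IsRegularAtPoint X (i (genericPoint S))) :
    letI : IsIntegral X := hX.isIntegral
    ∃ (Xt : Scheme.{u}) (_ : IsIntegral Xt) (ρ : Xt ⟶ X) (_ : IsFinite ρ) (_ : Surjective ρ)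
      (Sh : Scheme.{u}) (_ : IsIntegral Sh) (j : Sh ⟶ Xt) (_ : IsClosedImmersion j)
      (ν : St ⟶ Sh) (ρS : Sh ⟶ S),
      IsVarietyOver (ρ ≫ p) ∧ IsNormalScheme Xt ∧
      Surjective ρS ∧ j ≫ ρ = ρS ≫ i ∧ ν ≫ ρS = γ ∧
      IsNormalisation ν ∧
      morphismDegree ρ = morphismDegree γ := by
  have : IsIntegral X := hX.isIntegral
  -- Over a field there is no nonzero m with which to perturb a lift, so an inseparable extension
  -- could not be realised by a separable one. Here S = X, and S̃ itself serves as both covering and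
  -- subvariety.
  by_cases hR : IsField (X.presheaf.stalk (i (genericPoint S)))
  · have := isIso_of_isField_stalk i hR
    exact ⟨St, inferInstance, γ ≫ i, inferInstance, inferInstance, St, inferInstance, 𝟙 St,
      inferInstance, 𝟙 St, γ, by rwa [Category.assoc], hStn, inferInstance, Category.id_comp _,
      Category.id_comp _, hStn.isNormalisation_id, morphismDegree_comp_of_isIso γ i⟩
  · obtain ⟨Xt, hXt, ρ, hρ, hρ', Sh, hSh, j, hj, ν, ρS, h1, h2⟩ :
        ∃ (Xt : Scheme.{u}) (_ : IsIntegral Xt) (ρ : Xt ⟶ X) (_ : IsFinite ρ) (_ : Surjective ρ)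
          (Sh : Scheme.{u}) (_ : IsIntegral Sh) (j : Sh ⟶ Xt) (_ : IsClosedImmersion j)
          (ν : St ⟶ Sh) (ρS : Sh ⟶ S),
          IsNormalScheme Xt ∧ Surjective ρS ∧ j ≫ ρ = ρS ≫ i ∧ ν ≫ ρS = γ ∧
          IsNormalisation ν ∧ morphismDegree ρ = morphismDegree γ := by
      have := hX.locallyOfFiniteType
      have : IsLocallyNoetherian X := LocallyOfFiniteType.isLocallyNoetherian p
      let := residueFieldAlgebra i γ
      have := finite_residueFieldAlgebra i γ
      have key : ∃ (L : Type u) (_ : Field L) (_ : Algebra X.functionField L)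
          (_ : Algebra (X.presheaf.stalk (i (genericPoint S))) L)
          (_ : IsScalarTower (X.presheaf.stalk (i (genericPoint S))) X.functionField L),
          FiniteDimensional X.functionField L ∧ Algebra.IsSeparable X.functionField L ∧
          Module.finrank X.functionField L = Module.finrank
            (IsLocalRing.ResidueField (X.presheaf.stalk (i (genericPoint S)))) St.functionField ∧
          ∃ φ : integralClosure (X.presheaf.stalk (i (genericPoint S))) L →+* St.functionField,
            Function.Surjective φ ∧ φ.comp (algebraMap _ _) =
              (algebraMap (IsLocalRing.ResidueField (X.presheaf.stalk (i (genericPoint S))))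
                St.functionField).comp (IsLocalRing.residue _) := by
        rcases h with h | h
        -- Finite extensions of a perfect field are separable, so normality of the local ring is
        -- enough.
        · have : PerfectField
            (IsLocalRing.ResidueField (X.presheaf.stalk (i (genericPoint S)))) := h
          have := (hXn (i (genericPoint S))).2
          exact IsIntegrallyClosed.exists_separable_extension _ _ _
        · have : IsRegularLocalRing (X.presheaf.stalk (i (genericPoint S))) := h
          exact IsRegularLocalRing.exists_separable_extension _ hR _ _
      obtain ⟨L, _, _, _, _, _, _, hdeg, φ, hφ, hφψ⟩ := key
      exact exists_finite_covering i γ hXn hStn L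
        (hdeg.trans (morphismDegree_eq_finrank_residueField i γ).symm) φ hφ hφψ
    have := hX.isSeparated
    have := hX.locallyOfFiniteType
    have := hX.quasiCompact
    exact ⟨Xt, hXt, ρ, hρ, hρ', Sh, hSh, j, hj, ν, ρS,
      ⟨hXt, inferInstance, inferInstance, inferInstance⟩, h1, h2⟩
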